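/- Let $N\in\{2,3\}$, let $\alpha\in\mathbb{R}$ if $N=2$ and $\alpha<0$ if $N=3$, and let $1<p<\infty$ if $N=2$ and $1<p<2$ if $N=3$. For $\lambda>0$ let $G_\lambda\in L^2(\mathbb{R}^N)$ be the fundamental solution of $\lambda-\Delta$, i.e. $(\lambda-\Delta)G_\lambda=\delta_0$, and put $$\beta(\lambda)=\frac{1}{2\pi}\Bigl(\gamma+\log\frac{\sqrt\lambda}{2}\Bigr)\ (N=2),\qquad \beta(\lambda)=\frac{\sqrt\lambda}{4\pi}\ (N=3),$$ where $\gamma$ is the Euler–Mascheroni constant. Let $-\Delta_\alpha$ be the Laplacian with a point interaction of strength $\alpha$ at the origin, let $e_\alpha<0$ be its negative eigenvalue, i.e. $\alpha+\beta(-e_\alpha)=0$, so that $e_\alpha=-4e^{-4\pi\alpha-2\gamma}$ if $N=2$ and $e_\alpha=-(4\pi\alpha)^2$ if $N=3$, and let $\omega_\alpha=|e_\alpha|$. For $\omega\ge 0$ set $$X_\omega=\{f+cG_\lambda \mid f\in X_\omega^{\mathrm{reg}},\ c\in\mathbb{C}\},\qquad X_\omega^{\mathrm{reg}}=\begin{cases}H^1(\mathbb{R}^N;\mathbb{C}),&\omega>0,\\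 \{f\in L^{p+1}(\mathbb{R}^N;\mathbb{C})\mid \nabla f\in L^2\},&\omega=0,\end{cases}$$ with norm equivalent to $\|f\|_{X_\omega^{\mathrm{reg}}}+|c|$ for $u=f+cG_\lambda$ (where $\|f\|_{X_0^{\mathrm{reg}}}=\|f\|_{L^{p+1}}+\|\nabla f\|_{L^2}$), and for $u=f+cG_\lambda\in X_\omega$ let $$\langle-\Delta_\alpha u,u\rangle=\|\nabla f\|_{L^2}^2+\bigl(\alpha+\beta(\lambda)+\lambda\|G_\lambda\|_{L^2}^2\bigr)|c|^2-2\lambda\operatorname{Re}\Bigl(\overline{c}\int_{\mathbb{R}^N}u\,G_\lambda\,dx\Bigr),$$ $$S_\omega(u)=\tfrac12\langle-\Delta_\alpha u,u\rangle+\tfrac1{p+1}\|u\|_{L^{p+1}}^{p+1}+\tfrac\omega2\|u\|_{L^2}^2$$ (without the last term if $\omega=0$). Let $\mathcal{A}_\omega=\{\phi\in X_\omega\mid \phi\neq0,\ S_\omega'(\phi)=0\}$ be the set of nontrivial solutions of the stationary equation $(\omega-\Delta_\alpha)\phi+|\phi|^{p-1}\phi=0$, let $d(\omega)=\inf_{v\in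 X_\omega}S_\omega(v)$, and let $\mathcal{M}_\omega=\{v\in X_\omega\mid S_\omega(v)=d(\omega)\}$. Theorem. Let $0\le\omega<\omega_\alpha$. Then, for every choice of the decomposition parameter $\lambda>0$: 1. $\mathcal{A}_\omega\neq\emptyset$; 2. $S_\omega$ is bounded below on $X_\omega$, and $d(\omega)<0$; 3. $\mathcal{M}_\omega\neq\emptyset$ and $\mathcal{M}_\omega\subset\mathcal{A}_\omega$; 4. every sequence $(v_n)$ in $X_\omega$ with $S_\omega(v_n)\to d(\omega)$ has a subsequence that converges strongly in $X_\omega$ to an element of $\mathcal{M}_\omega$. -/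

import Mathlib

open MeasureTheory Filter Topology Set
open scoped ENNReal SchwartzMap LineDeriv

namespace PointInteraction

/-- `ℝ^N` with its Euclidean norm and Lebesgue measure. -/
abbrev Space (N : ℕ) : Type := EuclideanSpace ℝ (Fin N)

/-- The fundamental solution `G_lam` of `lam - Δ` on `ℝ^N` (`lam > 0`), i.e. the decaying solution of
`(lam - Δ) G = δ₀`, written as the Laplace transform in time of the Gauss heat kernel:
`G_lam(x) = ∫₀^∞ (4πt)^{-N/2} exp(-lam t - |x|²/(4t)) dt`.
(It equals `K₀(√lam |x|)/(2π)` for `N = 2` and `exp(-√lam |x|)/(4π|x|)` for `N = 3`; the value at the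
single point `x = 0` is irrelevant.) -/
noncomputable def green (N : ℕ) (lam : ℝ) (x : Space N) : ℝ :=
  ∫ t in Ioi (0 : ℝ),
    (4 * Real.pi * t) ^ (-((N : ℝ) / 2)) * Real.exp (-(lam * t) - ‖x‖ ^ 2 / (4 * t))

/-- The constant `β(lam)`; the second branch is the one for `N = 3`. -/
noncomputable def beta (N : ℕ) (lam : ℝ) : ℝ :=
  if N = 2 then (Real.eulerMascheroniConstant + Real.log (√lam / 2)) / (2 * Real.pi)
  else √lam / (4 * Real.pi)

/-- The negative eigenvalue `e_α` of `-Δ_α`, the unique `e < 0` with `α + β(-e) = 0`;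
the second branch is the one for `N = 3` (and `α < 0`). -/
noncomputable def eigenvalue (N : ℕ) (α : ℝ) : ℝ :=
  if N = 2 then -(4 * Real.exp (-(4 * Real.pi * α) - 2 * Real.eulerMascheroniConstant))
  else -(4 * Real.pi * α) ^ 2

/-- `ω_α = |e_α|`. -/
noncomputable def omegaMax (N : ℕ) (α : ℝ) : ℝ := |eigenvalue N α|

/-- The Lebesgue exponent of the regular part: `2` if `ω ≠ 0`, and `p + 1` if `ω = 0`. -/
noncomputable def regExponent (p ω : ℝ) : ℝ≥0∞ :=
  if ω = 0 then ENNReal.ofReal (p + 1) else 2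

instance fact_one_le_regExponent (p ω : ℝ) [hp : Fact (1 < p)] :
    Fact (1 ≤ regExponent p ω) := by
  refine ⟨?_⟩
  unfold regExponent
  split_ifs
  · rw [ENNReal.one_le_ofReal]
    linarith [hp.out]
  · exact one_le_two

/-- `L^q ∩ Ḣ¹`: the functions `f ∈ L^q(ℝ^N; ℂ)` whose distributional gradient is in `L²`.
An element is the pair `(f, ∇f)`, the second entry being determined by the first. The norm is
`max (‖f‖_{L^q}) (‖∇f‖_{L²})`, which is equivalent to the sum. For `q = 2` this is `H¹`. -/
noncomputable def regularSpace (N : ℕ) (q : ℝ≥0∞) [Fact (1 ≤ q)] :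
    Submodule ℂ (Lp ℂ q (volume : Measure (Space N)) ×
      PiLp 2 (fun _ : Fin N => Lp ℂ 2 (volume : Measure (Space N)))) where
  carrier := {g | ∀ i : Fin N,
    ∂_{(EuclideanSpace.single i (1 : ℝ) : Space N)} (g.1 : 𝓢'(Space N, ℂ))
      = (g.2 i : 𝓢'(Space N, ℂ))}
  zero_mem' := by
    intro i
    simp only [← Lp.toTemperedDistributionCLM_apply, Prod.fst_zero, Prod.snd_zero,
      PiLp.zero_apply, map_zero]
    exact LineDeriv.lineDerivOp_zero _
  add_mem' := by
    intro a b ha hb i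
    have h1 := ha i
    have h2 := hb i
    simp only [← Lp.toTemperedDistributionCLM_apply, Prod.fst_add, Prod.snd_add,
      PiLp.add_apply, map_add] at h1 h2 ⊢
    rw [LineDeriv.lineDerivOp_add, h1, h2]
  smul_mem' := by
    intro c a ha i
    have h1 := ha i
    simp only [← Lp.toTemperedDistributionCLM_apply, Prod.smul_fst, Prod.smul_snd,
      PiLp.smul_apply, map_smul] at h1 ⊢
    rw [LineDeriv.lineDerivOp_smul, h1]

/-- The space `X_ω = {f + c G_lam | f ∈ X_ω^reg, c ∈ ℂ}`, with `X_ω^reg = H¹` for `ω ≠ 0` and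
`X_0^reg = L^{p+1} ∩ Ḣ¹`. An element `f + c G_lam` is recorded by its regular part `f` and its
charge `c`; these are determined by the function `f + c G_lam` because `G_lam` has no
square-integrable gradient. The product norm `max (‖f‖_{X_ω^reg}) |c|` is equivalent to the usual
norms of `X_ω` (of `H¹_α` when `ω > 0`). -/
abbrev EnergySpace (N : ℕ) (p ω : ℝ) [Fact (1 < p)] : Type :=
  regularSpace N (regExponent p ω) × ℂ

section

variable {N : ℕ} {p ω : ℝ} [Fact (1 < p)]

/-- The regular part `f`. -/
noncomputable def regPart (v : EnergySpace N p ω) :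
    Lp ℂ (regExponent p ω) (volume : Measure (Space N)) := v.1.1.1

/-- The gradient `∇f` of the regular part; its norm is `‖∇f‖_{L²}`. -/
noncomputable def gradPart (v : EnergySpace N p ω) :
    PiLp 2 (fun _ : Fin N => Lp ℂ 2 (volume : Measure (Space N))) := v.1.1.2

/-- The function `f + c G_lam` on `ℝ^N`. -/
noncomputable def toFunction (lam : ℝ) (v : EnergySpace N p ω) (x : Space N) : ℂ :=
  regPart v x + v.2 * (green N lam x : ℂ)

/-- The quadratic form `⟨-Δ_α u, u⟩` at `u = f + c G_lam`:
`‖∇f‖² + (α + β(lam) + lam ‖G_lam‖²) |c|² - 2 lam Re (c̄ ⟨u, G_lam⟩)`. -/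
noncomputable def quadForm (α lam : ℝ) (v : EnergySpace N p ω) : ℝ :=
  ‖gradPart v‖ ^ 2
    + (α + beta N lam + lam * ∫ x : Space N, green N lam x ^ 2) * ‖v.2‖ ^ 2
    - 2 * lam * (starRingEnd ℂ v.2 * ∫ x : Space N, toFunction lam v x * (green N lam x : ℂ)).re

/-- The action
`S_ω(u) = ½ ⟨-Δ_α u, u⟩ + (p+1)⁻¹ ‖u‖_{L^{p+1}}^{p+1} + (ω/2) ‖u‖_{L²}²` on `X_ω`
(no last term if `ω = 0`). -/
noncomputable def action (α lam : ℝ) (v : EnergySpace N p ω) : ℝ :=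
  1 / 2 * quadForm α lam v
    + 1 / (p + 1) * (∫ x : Space N, ‖toFunction lam v x‖ ^ (p + 1))
    + ω / 2 * ∫ x : Space N, ‖toFunction lam v x‖ ^ 2

end

/-- `d(ω)`, the infimum of `S_ω` over `X_ω`. -/
noncomputable def leastAction (N : ℕ) (α p ω lam : ℝ) [Fact (1 < p)] : ℝ :=
  ⨅ v : EnergySpace N p ω, action α lam v

/-- `M_ω`, the set of minimizers of `S_ω` over `X_ω`. -/
def minimizers (N : ℕ) (α p ω lam : ℝ) [Fact (1 < p)] : Set (EnergySpace N p ω) :=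
  {v | action α lam v = leastAction N α p ω lam}

/-- `A_ω`, the set of nontrivial solutions of `(ω - Δ_α) φ + |φ|^{p-1} φ = 0`: the elements of `X_ω`
that are nonzero as functions and at which the (real) Fréchet derivative of `S_ω` vanishes. -/
def solutions (N : ℕ) (α p ω lam : ℝ) [Fact (1 < p)] : Set (EnergySpace N p ω) :=
  {φ | ¬ (toFunction lam φ =ᵐ[volume] 0) ∧
    HasFDerivAt (𝕜 := ℝ) (fun v : EnergySpace N p ω => action α lam v)
      (0 : EnergySpace N p ω →L[ℝ] ℝ) φ}

end PointInteraction

/-!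
Write `q = p + 1 > 2`, and let `u = f + c G` be the function attached to a regular part `f` and a
charge `c`. The action is `½` of a quadratic form plus `(1/q) ‖u‖_q^q`. In the quadratic form only
the terms that contain the charge can be negative.

*Control of the charge.* Since `∇G` is not square integrable, testing `u` with the Laplacian of a
smoothly truncated Green function shows that for every `ε > 0` there is `C` with
`|c| ≤ ε ‖∇f‖ + C ‖u‖_q` (`charge_estimate`). Hence the negative terms are at most
`¼ ‖∇f‖² + C ‖u‖_q²`, and as `q > 2` the action is bounded below and coercive
(`FormData.action_coercive`). The same estimate shows that `u = 0` forces `c = 0` and `f = 0`.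

*Compactness.* The parallelogram law for the quadratic form and Clarkson's inequality in `L^q` give
`S((x + y)/2) + S((x - y)/2) ≤ (S(x) + S(y))/2` (`FormData.action_midpoint_add_le`). Let `x, y` run
through a minimizing sequence. Its charges are bounded, so after passing to a subsequence they
converge; then the only possibly negative terms of `S((x - y)/2)` tend to `0`, and the inequality
bounds the remaining, nonnegative ones by `o(1)`. So the subsequence is a Cauchy sequence in the
energy space, which is complete, and its limit is a minimizer
(`FormData.exists_tendsto_of_tendsto_iInf`). No weak convergence or rearrangement is needed.

*Minimizers are nontrivial solutions.* The second differences `S(φ + h) + S(φ - h) - 2 S(φ)` are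
`O(‖h‖²)`, so the derivative vanishes at a minimizer `φ` (`FormData.isLittleO_action_of_isMin`).
A minimizer is not zero because `d(ω) < 0`: for `μ = ω_α`, the function
`G_μ = (G_μ - G_λ) + G_λ` is in the energy space, and the quadratic form, mass term included, takes
there the value `α + β(μ) - (μ - ω) ‖G_μ‖² = -(μ - ω) ‖G_μ‖² < 0` (`exists_quad_neg`), so that small
multiples of it have negative action.

The properties of the Green function are read off from its Fourier transform `1/(4π²|ξ|² + λ)`.
Its integrability exponents, and the Sobolev embedding of `H¹`, follow from a dyadic decomposition
in frequency (`memLp_fourierInv_of_dyadic_decay`); the function `β` enters through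
`(l - m) ∫ G_l G_m = β(l) - β(m)` (`mul_integral_symbols`).
-/

/-! ### Convexity and smoothness of the `q`-th power of the norm -/

namespace PointInteraction

lemma norm_rpow_eq_sq_rpow {E : Type*} [SeminormedAddCommGroup E] (a : E) (q : ℝ) :
    ‖a‖ ^ q = (‖a‖ ^ 2) ^ (q / 2) := by
  rw [← Real.rpow_natCast_mul (norm_nonneg _)]
  congr 1
  push_cast
  ring

/-- Clarkson's inequality for complex numbers. -/
lemma clarkson_pointwise {q : ℝ} (hq : 2 ≤ q) (a b : ℂ) :
    ‖(1 / 2 : ℝ) • (a + b)‖ ^ q + ‖(1 / 2 : ℝ) • (a - b)‖ ^ q ≤ (‖a‖ ^ q + ‖b‖ ^ q) / 2 := by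
  have hr : 1 ≤ q / 2 := by linarith
  have par := parallelogram_law_with_norm ℝ a b
  simp only [norm_rpow_eq_sq_rpow _ q]
  have h1 := Real.add_rpow_le_rpow_add (sq_nonneg ‖(1 / 2 : ℝ) • (a + b)‖)
    (sq_nonneg ‖(1 / 2 : ℝ) • (a - b)‖) hr
  refine h1.trans ?_
  have h2 : ‖(1 / 2 : ℝ) • (a + b)‖ ^ 2 + ‖(1 / 2 : ℝ) • (a - b)‖ ^ 2
      = (1 / 2 : ℝ) * ‖a‖ ^ 2 + (1 / 2 : ℝ) * ‖b‖ ^ 2 := by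
    rw [norm_smul, norm_smul, Real.norm_of_nonneg (by norm_num)]
    nlinarith
  rw [h2]
  have h3 := (convexOn_rpow hr).2 (sq_nonneg ‖a‖) (sq_nonneg ‖b‖)
    (show (0 : ℝ) ≤ 1 / 2 by norm_num) (show (0 : ℝ) ≤ 1 / 2 by norm_num) (by norm_num)
  simp only [smul_eq_mul] at h3
  linarith

lemma abs_rpow_sub_one_le {s : ℝ} (hs : 0 ≤ s) :
    ∃ C, 0 ≤ C ∧ ∀ v : ℝ, 0 ≤ v → v ≤ 4 → |v ^ s - 1| ≤ C * |v - 1| := by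
  obtain ⟨n, hn⟩ := exists_nat_ge s
  refine ⟨∑ i ∈ Finset.range n, (4 : ℝ) ^ i, by positivity, fun v hv0 hv4 => ?_⟩
  have key : |v ^ n - 1| ≤ (∑ i ∈ Finset.range n, (4 : ℝ) ^ i) * |v - 1| := by
    rw [← geom_sum_mul, abs_mul]
    gcongr
    refine (Finset.abs_sum_le_sum_abs _ _).trans ?_
    refine Finset.sum_le_sum fun i _ => ?_
    rw [abs_of_nonneg (by positivity)]
    gcongr
  refine le_trans ?_ key
  rw [← Real.rpow_natCast]
  rcases le_total 1 v with h | h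
  · have h1 := Real.one_le_rpow h hs
    have h2 := Real.rpow_le_rpow_of_exponent_le h hn
    rw [abs_of_nonneg (by linarith), abs_of_nonneg (by linarith)]
    linarith
  · have h1 := Real.rpow_le_one hv0 h hs
    rcases eq_or_lt_of_le hv0 with h0 | h0
    · subst h0
      rcases eq_or_lt_of_le hs with h3 | h3
      · subst h3
        simp
      · rw [Real.zero_rpow h3.ne', Real.zero_rpow (by linarith)]
    have h2 := Real.rpow_le_rpow_of_exponent_ge h0 h hn
    rw [abs_of_nonpos (by linarith), abs_of_nonpos (by linarith)]
    linarith

/-- A second order upper bound for the power function at `1`. -/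
lemma rpow_le_one_add_mul_add_sq {r : ℝ} (hr : 1 < r) :
    ∃ C, 0 ≤ C ∧ ∀ v : ℝ, 0 ≤ v → v ≤ 4 → v ^ r ≤ 1 + r * (v - 1) + C * (v - 1) ^ 2 := by
  obtain ⟨C, hC, h⟩ := abs_rpow_sub_one_le (s := r - 1) (by linarith)
  refine ⟨r * C, by positivity, fun v hv0 hv4 => ?_⟩
  have tangent : v ^ r ≤ 1 + r * ((v - 1) * v ^ (r - 1)) := by
    rcases eq_or_lt_of_le hv0 with h0 | h0
    · rw [← h0, Real.zero_rpow (by linarith), Real.zero_rpow (by linarith)]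
      simp
    · have hb := one_add_mul_self_le_rpow_one_add (s := v⁻¹ - 1)
        (by have := inv_pos.2 h0; linarith) hr.le
      have e : (1 + (v⁻¹ - 1)) ^ r * v ^ r = 1 := by
        rw [add_sub_cancel, ← Real.mul_rpow (by positivity) hv0, inv_mul_cancel₀ h0.ne',
          Real.one_rpow]
      have hv : 0 < v ^ r := by positivity
      have h2 := mul_le_mul_of_nonneg_right hb hv.le
      rw [e] at h2
      have h3 : v ^ r = v * v ^ (r - 1) := by
        rw [Real.rpow_sub_one h0.ne']
        field_simp
      have h4 : v⁻¹ * v ^ r = v ^ (r - 1) := by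
        rw [h3]
        field_simp
      nlinarith
  have h5 : (v - 1) * (v ^ (r - 1) - 1) ≤ C * (v - 1) ^ 2 := by
    refine (le_abs_self _).trans ?_
    rw [abs_mul, ← sq_abs (v - 1)]
    nlinarith [h v hv0 hv4, abs_nonneg (v - 1)]
  nlinarith

/-- The second difference of `‖·‖ ^ q` is quadratically small. -/
lemma norm_rpow_second_difference {q : ℝ} (hq : 2 < q) :
    ∃ C, 0 ≤ C ∧ ∀ a b : ℂ, ‖a + b‖ ^ q + ‖a - b‖ ^ q ≤
      2 * ‖a‖ ^ q + C * (‖a‖ ^ (q - 2) * ‖b‖ ^ 2 + ‖b‖ ^ q) := by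
  obtain ⟨C, hC, h⟩ := rpow_le_one_add_mul_add_sq (r := q / 2) (by linarith)
  refine ⟨2 * 2 ^ q + (q + 18 * C), by positivity, fun a b => ?_⟩
  have hab : 0 ≤ ‖a‖ ^ (q - 2) * ‖b‖ ^ 2 := by positivity
  have hb : 0 ≤ ‖b‖ ^ q := by positivity
  rcases le_or_gt ‖a‖ ‖b‖ with hle | hlt
  · have h1 : ‖a + b‖ ^ q ≤ 2 ^ q * ‖b‖ ^ q := by
      rw [← Real.mul_rpow (by norm_num) (norm_nonneg _)]
      gcongr
      linarith [norm_add_le a b]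
    have h2 : ‖a - b‖ ^ q ≤ 2 ^ q * ‖b‖ ^ q := by
      rw [← Real.mul_rpow (by norm_num) (norm_nonneg _)]
      gcongr
      linarith [norm_sub_le a b]
    have h3 : 0 ≤ ‖a‖ ^ q := by positivity
    have h4 : 0 ≤ (2 * 2 ^ q + (q + 18 * C)) * (‖a‖ ^ (q - 2) * ‖b‖ ^ 2) := by positivity
    have h5 : 0 ≤ (q + 18 * C) * ‖b‖ ^ q := by positivity
    nlinarith
  · have ha : 0 < ‖a‖ := (norm_nonneg b).trans_lt hlt
    set x := ‖a‖ with hx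
    set y := ‖b‖ with hy
    have hy0 : 0 ≤ y := norm_nonneg b
    have par := parallelogram_law_with_norm ℝ a b
    rw [← hx, ← hy] at par
    set P := ‖a + b‖ with hP
    set Q := ‖a - b‖ with hQ
    have hP1 : P ≤ x + y := norm_add_le a b
    have hQ1 : Q ≤ x + y := norm_sub_le a b
    have hP2 : x - y ≤ P := norm_sub_le_norm_add a b
    have hQ2 : x - y ≤ Q := norm_sub_norm_le a b
    have bound : ∀ R : ℝ, R ≤ x + y → x - y ≤ R → 0 ≤ R →
        R ^ q ≤ x ^ q + q / 2 * (R ^ 2 - x ^ 2) * x ^ (q - 2) + 9 * C * (x ^ (q - 2) * y ^ 2) := by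
      intro R h1 h2 h0
      have e1 : R ^ q = x ^ q * (R ^ 2 / x ^ 2) ^ (q / 2) := by
        rw [Real.div_rpow (by positivity) (by positivity), ← Real.rpow_natCast_mul h0,
          ← Real.rpow_natCast_mul ha.le]
        have : ((2 : ℕ) : ℝ) * (q / 2) = q := by push_cast; ring
        rw [this]
        field_simp
      have e2 : x ^ q = x ^ 2 * x ^ (q - 2) := by
        rw [← Real.rpow_natCast x 2, ← Real.rpow_add ha]
        congr 1
        push_cast
        ring
      have h3 := h (R ^ 2 / x ^ 2) (by positivity) (by rw [div_le_iff₀ (by positivity)]; nlinarith)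
      have h4 : (R ^ 2 / x ^ 2 - 1) ^ 2 ≤ 9 * y ^ 2 / x ^ 2 := by
        have : R ^ 2 / x ^ 2 - 1 = (R ^ 2 - x ^ 2) / x ^ 2 := by field_simp
        rw [this, div_pow, div_le_div_iff₀ (by positivity) (by positivity)]
        have h6 : |R ^ 2 - x ^ 2| ≤ 3 * x * y := by
          rw [abs_le]
          constructor <;> nlinarith
        have h7 : (R ^ 2 - x ^ 2) ^ 2 ≤ (3 * x * y) ^ 2 := by
          rw [← sq_abs]
          gcongr
        calc (R ^ 2 - x ^ 2) ^ 2 * x ^ 2 ≤ (3 * x * y) ^ 2 * x ^ 2 := by gcongr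
          _ = _ := by ring
      have h8 : (R ^ 2 / x ^ 2) ^ (q / 2) ≤
          1 + q / 2 * (R ^ 2 / x ^ 2 - 1) + C * (9 * y ^ 2 / x ^ 2) := by
        linarith [mul_le_mul_of_nonneg_left h4 hC]
      calc R ^ q = x ^ q * (R ^ 2 / x ^ 2) ^ (q / 2) := e1
        _ ≤ x ^ q * (1 + q / 2 * (R ^ 2 / x ^ 2 - 1) + C * (9 * y ^ 2 / x ^ 2)) := by gcongr
        _ = _ := by
          rw [e2]
          field_simp
    have b1 := bound P hP1 hP2 (norm_nonneg _)
    have b2 := bound Q hQ1 hQ2 (norm_nonneg _)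
    have e : P ^ 2 - x ^ 2 + (Q ^ 2 - x ^ 2) = 2 * y ^ 2 := by linarith
    have h5 : 0 ≤ (2 * 2 ^ q) * (x ^ (q - 2) * y ^ 2) := by positivity
    have h6 : 0 ≤ (2 * 2 ^ q + (q + 18 * C)) * y ^ q := by positivity
    have e3 : q / 2 * (P ^ 2 - x ^ 2) * x ^ (q - 2) + q / 2 * (Q ^ 2 - x ^ 2) * x ^ (q - 2)
        = q * (x ^ (q - 2) * y ^ 2) := by
      rw [← add_mul, ← mul_add, e]
      ring
    nlinarith

section Lp

variable {Y : Type*} [MeasurableSpace Y] {μ : Measure Y} {q : ℝ}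

lemma integrable_norm_rpow_of_Lp (hq : 0 < q) (A : Lp ℂ (ENNReal.ofReal q) μ) :
    Integrable (fun x => ‖A x‖ ^ q) μ := by
  have := (Lp.memLp A).integrable_norm_rpow (by simpa using hq) ENNReal.ofReal_ne_top
  simpa [ENNReal.toReal_ofReal hq.le] using this

lemma Lp_norm_rpow_eq (hq : 0 < q) (A : Lp ℂ (ENNReal.ofReal q) μ) :
    ‖A‖ ^ q = ∫ x, ‖A x‖ ^ q ∂μ := by
  have hi : 0 ≤ ∫ x, ‖A x‖ ^ q ∂μ := integral_nonneg fun x => by positivity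
  rw [Lp.norm_def, (Lp.memLp A).eLpNorm_eq_integral_rpow_norm (by simpa using hq)
    ENNReal.ofReal_ne_top, ENNReal.toReal_ofReal hq.le, ENNReal.toReal_ofReal (by positivity),
    ← Real.rpow_mul hi, inv_mul_cancel₀ hq.ne', Real.rpow_one]

lemma Lp_two_norm_sq_eq (A : Lp ℂ 2 μ) :
    ‖A‖ ^ 2 = ∫ x, ‖A x‖ ^ 2 ∂μ := by
  rw [← @inner_self_eq_norm_sq ℂ, L2.inner_def]
  have e : ∫ x, inner ℂ (A x) (A x) ∂μ = ∫ x, ((‖A x‖ ^ 2 : ℝ) : ℂ) ∂μ := by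
    refine integral_congr_ae (Eventually.of_forall fun x => ?_)
    simp only [inner_self_eq_norm_sq_to_K, Complex.coe_algebraMap, Complex.ofReal_pow]
  rw [e, integral_complex_ofReal]
  simp

/-- Clarkson's inequality in `L^q`, `q ≥ 2`. -/
lemma clarkson_Lp (hq : 2 ≤ q) (A B : Lp ℂ (ENNReal.ofReal q) μ) :
    ‖(1 / 2 : ℝ) • (A + B)‖ ^ q + ‖(1 / 2 : ℝ) • (A - B)‖ ^ q ≤ (‖A‖ ^ q + ‖B‖ ^ q) / 2 := by
  have hq0 : 0 < q := by linarith
  simp only [Lp_norm_rpow_eq hq0]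
  rw [← integral_add (integrable_norm_rpow_of_Lp hq0 _) (integrable_norm_rpow_of_Lp hq0 _),
    ← integral_add (integrable_norm_rpow_of_Lp hq0 _) (integrable_norm_rpow_of_Lp hq0 _),
    ← integral_div]
  refine integral_mono_ae
    ((integrable_norm_rpow_of_Lp hq0 _).add (integrable_norm_rpow_of_Lp hq0 _))
    (((integrable_norm_rpow_of_Lp hq0 _).add (integrable_norm_rpow_of_Lp hq0 _)).div_const _) ?_
  filter_upwards [Lp.coeFn_smul (1 / 2 : ℝ) (A + B), Lp.coeFn_smul (1 / 2 : ℝ) (A - B),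
    Lp.coeFn_add A B, Lp.coeFn_sub A B] with x h1 h2 h3 h4
  simp only [h1, h2, Pi.smul_apply, h3, h4, Pi.add_apply, Pi.sub_apply]
  exact clarkson_pointwise hq _ _

/-- The second difference of `‖·‖ ^ q` on `L^q`, `q > 2`, is quadratically small on bounded sets.
The mixed term `|a|^(q-2) |b|²` is estimated by Young's inequality with `b` normalized. -/
lemma Lp_second_difference (hq : 2 < q) :
    ∃ C, 0 ≤ C ∧ ∀ A B : Lp ℂ (ENNReal.ofReal q) μ, ‖A + B‖ ^ q + ‖A - B‖ ^ q ≤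
      2 * ‖A‖ ^ q + C * (‖B‖ ^ 2 * (‖A‖ ^ q + 1) + ‖B‖ ^ q) := by
  have hq0 : 0 < q := by linarith
  obtain ⟨C, hC, h⟩ := norm_rpow_second_difference hq
  refine ⟨C, hC, fun A B => ?_⟩
  have : Fact ((1 : ℝ≥0∞) ≤ ENNReal.ofReal q) := ⟨by rw [ENNReal.one_le_ofReal]; linarith⟩
  rcases eq_or_ne B 0 with rfl | hB
  · have h0 : (0 : ℝ) ≤ C * (‖(0 : Lp ℂ (ENNReal.ofReal q) μ)‖ ^ 2 * (‖A‖ ^ q + 1)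
      + ‖(0 : Lp ℂ (ENNReal.ofReal q) μ)‖ ^ q) := by positivity
    rw [add_zero, sub_zero]
    linarith
  have ht : 0 < ‖B‖ := norm_pos_iff.2 hB
  set t := ‖B‖ with ht_def
  have young : ∀ x y : ℝ, 0 ≤ x → 0 ≤ y →
      x ^ (q - 2) * y ^ 2 ≤ t ^ 2 * (x ^ q + (t ^ q)⁻¹ * y ^ q) := by
    intro x y hx hy
    obtain ⟨z, hz, rfl⟩ : ∃ z, 0 ≤ z ∧ y = t * z := ⟨y / t, by positivity, by field_simp⟩
    have e1 : (t ^ q)⁻¹ * (t * z) ^ q = z ^ q := by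
      rw [Real.mul_rpow ht.le hz]
      field_simp
    rw [e1, mul_pow, mul_left_comm]
    gcongr
    have e2 : ∀ w : ℝ, 0 ≤ w → w ^ (q - 2) * w ^ 2 = w ^ q := by
      intro w hw
      rw [← Real.rpow_natCast w 2, ← Real.rpow_add_of_nonneg hw (by linarith) (by norm_num)]
      congr 1
      push_cast
      ring
    have hx' : 0 ≤ x ^ q := by positivity
    have hz' : 0 ≤ z ^ q := by positivity
    rcases le_total x z with hxz | hxz
    · calc x ^ (q - 2) * z ^ 2 ≤ z ^ (q - 2) * z ^ 2 := by
            gcongr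
        _ ≤ _ := by rw [e2 z hz]; linarith
    · calc x ^ (q - 2) * z ^ 2 ≤ x ^ (q - 2) * x ^ 2 := by gcongr
        _ ≤ _ := by rw [e2 x hx]; linarith
  have i1 := integrable_norm_rpow_of_Lp hq0 A
  have i2 := integrable_norm_rpow_of_Lp hq0 B
  have key : ∫ x, (‖(A + B) x‖ ^ q + ‖(A - B) x‖ ^ q) ∂μ ≤
      ∫ x, ((2 + C * t ^ 2) * ‖A x‖ ^ q + (C * t ^ 2 * (t ^ q)⁻¹ + C) * ‖B x‖ ^ q) ∂μ := by
    refine integral_mono_ae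
      ((integrable_norm_rpow_of_Lp hq0 _).add (integrable_norm_rpow_of_Lp hq0 _))
      ((i1.const_mul _).add (i2.const_mul _)) ?_
    filter_upwards [Lp.coeFn_add A B, Lp.coeFn_sub A B] with x h3 h4
    simp only [h3, h4, Pi.add_apply, Pi.sub_apply]
    refine (h _ _).trans ?_
    have h5 := mul_le_mul_of_nonneg_left (young _ _ (norm_nonneg (A x)) (norm_nonneg (B x))) hC
    linarith
  rw [integral_add (integrable_norm_rpow_of_Lp hq0 _) (integrable_norm_rpow_of_Lp hq0 _),
    integral_add (i1.const_mul _) (i2.const_mul _), integral_const_mul, integral_const_mul] at key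
  simp only [← Lp_norm_rpow_eq hq0, ← ht_def] at key
  refine key.trans (le_of_eq ?_)
  field_simp
  ring

end Lp

end PointInteraction

/-! ### Fourier transform of `L²` functions -/

namespace PointInteraction
open FourierTransform

variable {N : ℕ}

lemma ae_eq_of_forall_schwartz {f g : Space N → ℂ} (hf : LocallyIntegrable f)
    (hg : LocallyIntegrable g) (h : ∀ φ : 𝓢(Space N, ℂ), ∫ x, φ x • f x = ∫ x, φ x • g x) :
    f =ᵐ[volume] g := by
  refine ae_eq_of_integral_contDiff_smul_eq hf hg fun φ φ_smooth φ_cpt => ?_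
  have h1 : HasCompactSupport (Complex.ofRealCLM ∘ φ) := φ_cpt.comp_left rfl
  have h2 : ContDiff ℝ ((⊤ : ℕ∞) : WithTop ℕ∞) (Complex.ofRealCLM ∘ φ) := by fun_prop
  simpa using h (h1.toSchwartzMap h2)

lemma integral_schwartz_smul_fourier {f : Space N → ℂ} (hf : Integrable f)
    (φ : 𝓢(Space N, ℂ)) : ∫ x, φ x • 𝓕 f x = ∫ x, 𝓕 φ x • f x := by
  have := VectorFourier.integral_fourierIntegral_smul_eq_flip (L := innerₗ (Space N))
    (μ := volume) (ν := volume) Real.continuous_fourierChar continuous_inner φ.integrable hf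
  rw [flip_innerₗ] at this
  simpa [SchwartzMap.fourier_coe] using! this.symm

lemma integral_schwartz_smul_fourierInv {f : Space N → ℂ} (hf : Integrable f)
    (φ : 𝓢(Space N, ℂ)) : ∫ x, φ x • 𝓕⁻ f x = ∫ x, 𝓕⁻ φ x • f x := by
  have h := integral_schwartz_smul_fourier hf.comp_neg φ
  rw [← integral_neg_eq_self] at h
  have e1 : 𝓕⁻ f = 𝓕 (fun x => f (-x)) := Real.fourierInv_eq_fourier_comp_neg f
  rw [e1, ← integral_neg_eq_self (fun x => 𝓕⁻ φ x • f x)]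
  rw [integral_neg_eq_self (fun x => φ x • 𝓕 (fun x => f (-x)) x)] at h
  rw [h]
  refine integral_congr_ae (Eventually.of_forall fun x => ?_)
  simp only [SchwartzMap.fourierInv_coe, SchwartzMap.fourier_coe]
  rw [Real.fourierInv_eq_fourier_neg, neg_neg]

lemma integral_schwartz_smul_Lp_fourierInv (w : Lp ℂ 2 (volume : Measure (Space N)))
    (φ : 𝓢(Space N, ℂ)) : ∫ x, φ x • (𝓕⁻ w : Lp ℂ 2 (volume : Measure (Space N))) x
      = ∫ x, 𝓕⁻ φ x • w x := by
  rw [← Lp.toTemperedDistribution_apply, ← Lp.toTemperedDistribution_apply,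
    ← Lp.fourierInv_toTemperedDistribution_eq, TemperedDistribution.fourierInv_apply]

lemma integral_schwartz_smul_Lp_fourier (w : Lp ℂ 2 (volume : Measure (Space N)))
    (φ : 𝓢(Space N, ℂ)) : ∫ x, φ x • (𝓕 w : Lp ℂ 2 (volume : Measure (Space N))) x
      = ∫ x, 𝓕 φ x • w x := by
  rw [← Lp.toTemperedDistribution_apply, ← Lp.toTemperedDistribution_apply,
    ← Lp.fourier_toTemperedDistribution_eq, TemperedDistribution.fourier_apply]

/-- On `L¹ ∩ L²` the inverse Fourier transform of `L²` is given by the Fourier integral. -/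
lemma Lp_fourierInv_ae_eq {w : Lp ℂ 2 (volume : Measure (Space N))}
    (hw : Integrable (w : Space N → ℂ)) :
    (𝓕⁻ w : Lp ℂ 2 (volume : Measure (Space N))) =ᵐ[volume] 𝓕⁻ (w : Space N → ℂ) := by
  have hc : Continuous (𝓕⁻ (w : Space N → ℂ)) := by
    rw [← Real.Lp.fourierTransformInv_toLp (memLp_one_iff_integrable.2 hw)]
    exact (Real.Lp.fourierTransformInv _).continuous
  refine ae_eq_of_forall_schwartz ((Lp.memLp _).locallyIntegrable one_le_two)
    hc.locallyIntegrable fun φ => ?_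
  rw [integral_schwartz_smul_Lp_fourierInv, integral_schwartz_smul_fourierInv hw]

/-- Fourier inversion for an integrable function with square-integrable Fourier transform. -/
lemma ae_eq_fourierInv_of_memLp_fourier {g : Space N → ℂ} (hg : Integrable g)
    (h : MemLp (𝓕 g) 2) :
    (𝓕⁻ (h.toLp _) : Lp ℂ 2 (volume : Measure (Space N))) =ᵐ[volume] g := by
  refine ae_eq_of_forall_schwartz ((Lp.memLp _).locallyIntegrable one_le_two)
    hg.locallyIntegrable fun φ => ?_
  rw [integral_schwartz_smul_Lp_fourierInv]
  have e : ∫ x, 𝓕⁻ φ x • (h.toLp (𝓕 g)) x = ∫ x, 𝓕⁻ φ x • 𝓕 g x :=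
    integral_congr_ae (by filter_upwards [h.coeFn_toLp] with x hx; rw [hx])
  rw [e, integral_schwartz_smul_fourier hg, fourier_fourierInv_eq]

lemma norm_fourierInv_le (f : Space N → ℂ) (x : Space N) : ‖𝓕⁻ f x‖ ≤ ∫ v, ‖f v‖ := by
  rw [Real.fourierInv_eq_fourier_neg]
  exact VectorFourier.norm_fourierIntegral_le_integral_norm _ _ _ _ _

lemma eLpNorm_le_of_bound_of_eLpNorm_two_le {Y : Type*} [MeasurableSpace Y] {μ : Measure Y}
    {F : Y → ℂ} {q S T : ℝ} (hq : 2 ≤ q) (hS : 0 ≤ S) (hT : 0 ≤ T)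
    (hFS : ∀ᵐ x ∂μ, ‖F x‖ ≤ S) (hFT : eLpNorm F 2 μ ≤ ENNReal.ofReal T) :
    eLpNorm F (ENNReal.ofReal q) μ ≤ ENNReal.ofReal ((S ^ (q - 2) * T ^ 2) ^ (1 / q)) := by
  have hq0 : 0 < q := by linarith
  have h2 : ∫⁻ x, ‖F x‖ₑ ^ (2 : ℝ) ∂μ ≤ ENNReal.ofReal (T ^ 2) := by
    have := ENNReal.rpow_le_rpow hFT (z := 2) (by norm_num)
    rw [eLpNorm_eq_lintegral_rpow_enorm_toReal (by norm_num) (by norm_num), ← ENNReal.rpow_mul,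
      ENNReal.ofReal_rpow_of_nonneg hT (by norm_num)] at this
    simpa using this
  rw [eLpNorm_eq_lintegral_rpow_enorm_toReal (by simpa using hq0) ENNReal.ofReal_ne_top,
    ENNReal.toReal_ofReal hq0.le, ← ENNReal.ofReal_rpow_of_nonneg (by positivity) (by positivity)]
  gcongr
  calc ∫⁻ x, ‖F x‖ₑ ^ q ∂μ ≤ ∫⁻ x, ENNReal.ofReal (S ^ (q - 2)) * ‖F x‖ₑ ^ (2 : ℝ) ∂μ := by
        refine lintegral_mono_ae ?_
        filter_upwards [hFS] with x hx
        have e : ‖F x‖ₑ ^ q = ‖F x‖ₑ ^ (q - 2) * ‖F x‖ₑ ^ (2 : ℝ) := by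
          rw [← ENNReal.rpow_add_of_nonneg _ _ (by linarith) (by norm_num)]
          congr 1
          ring
        rw [e, ← ENNReal.ofReal_rpow_of_nonneg hS (by linarith)]
        gcongr
        rw [← ofReal_norm]
        exact ENNReal.ofReal_le_ofReal hx
    _ ≤ _ := by
        rw [lintegral_const_mul' _ _ ENNReal.ofReal_ne_top, ENNReal.ofReal_mul (by positivity)]
        gcongr

/-- Bernstein's inequality: if `w ∈ L²` lives in a ball of radius `R`, then the `L^q` norm of its
inverse Fourier transform costs a factor `R ^ a`, `a = (N/2) (1 - 2/q)`. -/
lemma bernstein {q : ℝ} (hq : 2 ≤ q) : ∃ A : ℝ, 0 ≤ A ∧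
    ∀ (w : Lp ℂ 2 (volume : Measure (Space N))) (R T : ℝ), 0 < R → ‖w‖ ≤ T →
      (∀ᵐ x, x ∉ Metric.ball (0 : Space N) R → w x = 0) →
      eLpNorm (𝓕⁻ w : Lp ℂ 2 (volume : Measure (Space N))) (ENNReal.ofReal q) volume ≤
        ENNReal.ofReal (A * T * R ^ ((N : ℝ) / 2 * (1 - 2 / q))) := by
  have hq0 : 0 < q := by linarith
  set K : ℝ := volume.real (Metric.ball (0 : Space N) 1) with hK
  have hK0 : 0 ≤ K := measureReal_nonneg
  refine ⟨(K ^ (1 / 2 : ℝ)) ^ (1 - 2 / q), by positivity, fun w R T hR hwT hw => ?_⟩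
  have hT : 0 ≤ T := (norm_nonneg _).trans hwT
  set B := Metric.ball (0 : Space N) R with hB
  have hBfin : volume B ≠ ∞ := measure_ball_lt_top.ne
  have hwB : (w : Space N → ℂ) =ᵐ[volume] B.indicator w := by
    filter_upwards [hw] with x hx
    by_cases hxB : x ∈ B
    · rw [indicator_of_mem hxB]
    · rw [indicator_of_notMem hxB, hx hxB]
  have h1 : eLpNorm w 1 volume ≤ ENNReal.ofReal (K ^ (1 / 2 : ℝ) * R ^ ((N : ℝ) / 2) * T) := by
    rw [eLpNorm_congr_ae hwB, eLpNorm_indicator_eq_eLpNorm_restrict measurableSet_ball]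
    refine (eLpNorm_le_eLpNorm_mul_rpow_measure_univ (one_le_two)
      (Lp.aestronglyMeasurable w).restrict).trans ?_
    have e1 : (volume.restrict B) univ = ENNReal.ofReal (R ^ N * K) := by
      rw [Measure.restrict_apply_univ, hB, Measure.addHaar_ball_of_pos _ _ hR,
        ENNReal.ofReal_mul (by positivity), hK, ofReal_measureReal measure_ball_lt_top.ne]
      simp
    rw [e1, ENNReal.ofReal_rpow_of_nonneg (by positivity) (by norm_num)]
    have e2 : eLpNorm w 2 (volume.restrict B) ≤ ENNReal.ofReal T := by
      refine (eLpNorm_restrict_le _ _ _ _).trans ?_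
      rw [← ENNReal.ofReal_toReal (Lp.eLpNorm_ne_top w)]
      exact ENNReal.ofReal_le_ofReal hwT
    refine (mul_le_mul_left e2 _).trans ?_
    rw [← ENNReal.ofReal_mul hT]
    refine ENNReal.ofReal_le_ofReal (le_of_eq ?_)
    have e3 : (1 / (1 : ℝ≥0∞).toReal - 1 / (2 : ℝ≥0∞).toReal) = (1 / 2 : ℝ) := by norm_num
    rw [e3, Real.mul_rpow (by positivity) hK0, ← Real.rpow_natCast_mul hR.le]
    have e4 : (N : ℝ) * (1 / 2) = (N : ℝ) / 2 := by ring
    rw [e4]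
    ring
  have hwint : Integrable (w : Space N → ℂ) := by
    rw [← memLp_one_iff_integrable]
    exact ⟨Lp.aestronglyMeasurable w, h1.trans_lt ENNReal.ofReal_lt_top⟩
  have hS0 : 0 ≤ K ^ (1 / 2 : ℝ) * R ^ ((N : ℝ) / 2) * T := by positivity
  have h2 : ∀ᵐ x, ‖(𝓕⁻ w : Lp ℂ 2 (volume : Measure (Space N))) x‖ ≤
      K ^ (1 / 2 : ℝ) * R ^ ((N : ℝ) / 2) * T := by
    filter_upwards [Lp_fourierInv_ae_eq hwint] with x hx
    rw [hx]
    refine (norm_fourierInv_le _ _).trans ?_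
    rw [integral_norm_eq_lintegral_enorm hwint.1, ← eLpNorm_one_eq_lintegral_enorm]
    exact ENNReal.toReal_le_of_le_ofReal hS0 h1
  have h3 : eLpNorm (𝓕⁻ w : Lp ℂ 2 (volume : Measure (Space N))) 2 volume ≤ ENNReal.ofReal T := by
    rw [← ENNReal.ofReal_toReal (Lp.eLpNorm_ne_top _), ← Lp.norm_def]
    refine ENNReal.ofReal_le_ofReal ?_
    have : ‖(𝓕⁻ w : Lp ℂ 2 (volume : Measure (Space N)))‖ = ‖w‖ := by
      rw [← Lp.norm_fourier_eq, fourier_fourierInv_eq]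
    rwa [this]
  refine (eLpNorm_le_of_bound_of_eLpNorm_two_le hq hS0 hT h2 h3).trans
    (ENNReal.ofReal_le_ofReal (le_of_eq ?_))
  have e5 : (1 - 2 / q) = (q - 2) * (1 / q) := by field_simp
  rw [e5, Real.rpow_mul (by positivity : 0 ≤ K ^ (1 / 2 : ℝ)), Real.rpow_mul (by positivity : 0 ≤ R),
    Real.rpow_mul (by positivity : 0 ≤ R ^ ((N : ℝ) / 2))]
  have e6 : T = (T ^ q) ^ (1 / q) := by
    rw [← Real.rpow_mul hT, mul_one_div_cancel hq0.ne', Real.rpow_one]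
  have e7 : T ^ q = T ^ (q - 2) * T ^ 2 := by
    rw [← Real.rpow_natCast T 2, ← Real.rpow_add_of_nonneg hT (by linarith) (by norm_num)]
    congr 1
    push_cast
    ring
  have e8 : (K ^ (1 / 2 : ℝ) * R ^ ((N : ℝ) / 2) * T) ^ (q - 2) * T ^ 2
      = (K ^ (1 / 2 : ℝ)) ^ (q - 2) * T ^ q * (R ^ ((N : ℝ) / 2)) ^ (q - 2) := by
    rw [Real.mul_rpow (by positivity) hT, Real.mul_rpow (by positivity) (by positivity), e7]
    ring
  rw [e8, Real.mul_rpow (by positivity) (by positivity),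
    Real.mul_rpow (by positivity) (by positivity), ← e6]

/-- The restriction of an `L²` function to a set. -/
noncomputable def cutoff (s : Set (Space N)) (hs : MeasurableSet s)
    (w : Lp ℂ 2 (volume : Measure (Space N))) : Lp ℂ 2 (volume : Measure (Space N)) :=
  ((Lp.memLp w).indicator hs).toLp _

lemma coeFn_cutoff {s : Set (Space N)} (hs : MeasurableSet s)
    (w : Lp ℂ 2 (volume : Measure (Space N))) : cutoff s hs w =ᵐ[volume] s.indicator w :=
  MemLp.coeFn_toLp _

lemma tendsto_cutoff_ball (w : Lp ℂ 2 (volume : Measure (Space N))) :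
    Tendsto (fun k : ℕ => cutoff (Metric.ball 0 (2 ^ k)) measurableSet_ball w) atTop (𝓝 w) := by
  rw [Lp.tendsto_Lp_iff_tendsto_eLpNorm']
  have hfin : ∫⁻ x, ‖w x‖ₑ ^ (2 : ℝ) ≠ ∞ := by
    have := (lintegral_rpow_enorm_lt_top_of_eLpNorm_lt_top (by norm_num) (by norm_num)
      (Lp.eLpNorm_lt_top w)).ne
    simpa using this
  have key : Tendsto (fun k : ℕ =>
      ∫⁻ x, ‖(cutoff (Metric.ball 0 (2 ^ k)) measurableSet_ball w - w) x‖ₑ ^ (2 : ℝ)) atTop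
      (𝓝 (∫⁻ _ : Space N, 0)) := by
    refine tendsto_lintegral_of_dominated_convergence' (fun x => ‖w x‖ₑ ^ (2 : ℝ))
      (fun k => (Lp.aestronglyMeasurable _).enorm.pow_const _) (fun k => ?_) hfin ?_
    · filter_upwards [coeFn_cutoff (measurableSet_ball (x := (0 : Space N)) (ε := 2 ^ k)) w,
        Lp.coeFn_sub (cutoff (Metric.ball 0 (2 ^ k)) measurableSet_ball w) w] with x h1 h2
      rw [h2, Pi.sub_apply, h1]
      by_cases hx : x ∈ Metric.ball (0 : Space N) (2 ^ k)
      · simp [indicator_of_mem hx]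
      · simp [indicator_of_notMem hx]
    · have h1 : ∀ᵐ x, ∀ k : ℕ, (cutoff (Metric.ball 0 (2 ^ k)) measurableSet_ball w - w) x
          = (Metric.ball (0 : Space N) (2 ^ k)).indicator w x - w x := by
        rw [ae_all_iff]
        intro k
        filter_upwards [coeFn_cutoff (measurableSet_ball (x := (0 : Space N)) (ε := 2 ^ k)) w,
          Lp.coeFn_sub (cutoff (Metric.ball 0 (2 ^ k)) measurableSet_ball w) w] with x h1 h2
        rw [h2, Pi.sub_apply, h1]
      filter_upwards [h1] with x hx
      refine tendsto_const_nhds.congr' ?_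
      obtain ⟨n, hn⟩ := pow_unbounded_of_one_lt ‖x‖ (one_lt_two (α := ℝ))
      filter_upwards [eventually_ge_atTop n] with k hk
      have : x ∈ Metric.ball (0 : Space N) (2 ^ k) := by
        rw [mem_ball_zero_iff]
        exact hn.trans_le (pow_le_pow_right₀ one_le_two hk)
      rw [hx k, indicator_of_mem this, sub_self, enorm_zero, ENNReal.zero_rpow_of_pos two_pos]
  rw [lintegral_zero] at key
  have h2 := key.ennrpow_const (1 / 2)
  rw [ENNReal.zero_rpow_of_pos (by norm_num)] at h2
  refine h2.congr fun k => ?_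
  rw [← eLpNorm_congr_ae (Lp.coeFn_sub _ _), eLpNorm_eq_lintegral_rpow_enorm_toReal (by norm_num)
    (by norm_num), ENNReal.toReal_ofNat]

/-- If the dyadic pieces of `w ∈ L²` decay faster than the loss in Bernstein's inequality, then the
inverse Fourier transform of `w` is in `L^q`: the dyadic partial sums are bounded in `L^q`, and
Fatou's lemma applies along an almost everywhere convergent subsequence. -/
lemma memLp_fourierInv_of_dyadic_decay {q C σ : ℝ} (hq : 2 ≤ q) (hC : 0 ≤ C)
    (hσ : (N : ℝ) / 2 * (1 - 2 / q) < σ) (w : Lp ℂ 2 (volume : Measure (Space N)))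
    (hw : ∀ k : ℕ, ‖cutoff (Metric.ball 0 (2 ^ (k + 1)) \ Metric.ball 0 (2 ^ k))
      (measurableSet_ball.diff measurableSet_ball) w‖ ≤ C * (2 ^ (-σ)) ^ k) :
    MemLp (𝓕⁻ w : Lp ℂ 2 (volume : Measure (Space N))) (ENNReal.ofReal q) := by
  obtain ⟨A, hA, hbern⟩ := bernstein (N := N) hq
  set a := (N : ℝ) / 2 * (1 - 2 / q) with ha
  set ρ : ℝ := 2 ^ (a - σ) with hρ
  have hρ0 : 0 ≤ ρ := by positivity
  have hρ1 : ρ < 1 := Real.rpow_lt_one_of_one_lt_of_neg one_lt_two (by linarith)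
  set s : ℕ → Lp ℂ 2 (volume : Measure (Space N)) :=
    fun k => cutoff (Metric.ball 0 (2 ^ k)) measurableSet_ball w with hs
  set d : ℕ → Lp ℂ 2 (volume : Measure (Space N)) :=
    fun k => cutoff (Metric.ball 0 (2 ^ (k + 1)) \ Metric.ball 0 (2 ^ k))
      (measurableSet_ball.diff measurableSet_ball) w with hd
  have hq1 : 1 ≤ ENNReal.ofReal q := by rw [ENNReal.one_le_ofReal]; linarith
  have hsucc : ∀ k, s (k + 1) = s k + d k := by
    intro k
    refine Lp.ext ?_
    filter_upwards [coeFn_cutoff (measurableSet_ball (x := (0 : Space N)) (ε := 2 ^ k)) w,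
      coeFn_cutoff (measurableSet_ball (x := (0 : Space N)) (ε := 2 ^ (k + 1))) w,
      coeFn_cutoff ((measurableSet_ball (x := (0 : Space N)) (ε := 2 ^ (k + 1))).diff
        (measurableSet_ball (x := (0 : Space N)) (ε := 2 ^ k))) w,
      Lp.coeFn_add (s k) (d k)] with x h1 h2 h3 h4
    rw [h4, Pi.add_apply, h1, h2, h3]
    have hsub : Metric.ball (0 : Space N) (2 ^ k) ⊆ Metric.ball 0 (2 ^ (k + 1)) :=
      Metric.ball_subset_ball (pow_le_pow_right₀ one_le_two (Nat.le_succ k))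
    by_cases hx1 : x ∈ Metric.ball (0 : Space N) (2 ^ k)
    · simp [indicator, hx1, hsub hx1]
    · simp [indicator, hx1]
  have hdq : ∀ k, eLpNorm (𝓕⁻ (d k) : Lp ℂ 2 (volume : Measure (Space N))) (ENNReal.ofReal q)
      volume ≤ ENNReal.ofReal (A * C * 2 ^ a * ρ ^ k) := by
    intro k
    refine (hbern (d k) (2 ^ (k + 1)) (C * (2 ^ (-σ)) ^ k) (by positivity) (hw k) ?_).trans
      (ENNReal.ofReal_le_ofReal (le_of_eq ?_))
    · filter_upwards [coeFn_cutoff ((measurableSet_ball (x := (0 : Space N))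
        (ε := 2 ^ (k + 1))).diff (measurableSet_ball (x := (0 : Space N)) (ε := 2 ^ k))) w]
        with x h1 hx
      rw [h1, indicator_of_notMem fun h => hx h.1]
    · have e1 : ρ ^ k = (2 ^ a) ^ k * (2 ^ (-σ)) ^ k := by
        rw [← mul_pow, ← Real.rpow_add two_pos, hρ, sub_eq_add_neg]
      have e2 : ((2 : ℝ) ^ (k + 1)) ^ a = 2 ^ a * (2 ^ a) ^ k := by
        rw [← Real.rpow_natCast_mul two_pos.le, ← Real.rpow_mul_natCast two_pos.le,
          ← Real.rpow_add two_pos]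
        congr 1
        push_cast
        ring
      rw [e1, e2]
      ring
  have hs0 : eLpNorm (𝓕⁻ (s 0) : Lp ℂ 2 (volume : Measure (Space N))) (ENNReal.ofReal q)
      volume < ∞ := by
    refine (hbern (s 0) 1 ‖s 0‖ one_pos le_rfl ?_).trans_lt ENNReal.ofReal_lt_top
    filter_upwards [coeFn_cutoff (measurableSet_ball (x := (0 : Space N)) (ε := 2 ^ 0)) w]
      with x h1 hx
    rw [h1, indicator_of_notMem (by simpa using hx)]
  have hsum : ∀ k, eLpNorm (𝓕⁻ (s k) : Lp ℂ 2 (volume : Measure (Space N))) (ENNReal.ofReal q)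
      volume ≤ eLpNorm (𝓕⁻ (s 0) : Lp ℂ 2 (volume : Measure (Space N))) (ENNReal.ofReal q) volume
        + ENNReal.ofReal (∑ i ∈ Finset.range k, A * C * 2 ^ a * ρ ^ i) := by
    intro k
    induction k with
    | zero => simp
    | succ k ih =>
      rw [hsucc k, FourierTransform.fourierInv_add, eLpNorm_congr_ae (Lp.coeFn_add _ _)]
      refine (eLpNorm_add_le (Lp.aestronglyMeasurable _) (Lp.aestronglyMeasurable _) hq1).trans ?_
      rw [Finset.sum_range_succ, ENNReal.ofReal_add
        (Finset.sum_nonneg fun i _ => by positivity) (by positivity), ← add_assoc]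
      exact add_le_add ih (hdq k)
  have hbound : ∀ k, eLpNorm (𝓕⁻ (s k) : Lp ℂ 2 (volume : Measure (Space N))) (ENNReal.ofReal q)
      volume ≤ eLpNorm (𝓕⁻ (s 0) : Lp ℂ 2 (volume : Measure (Space N))) (ENNReal.ofReal q) volume
        + ENNReal.ofReal (A * C * 2 ^ a * (1 - ρ)⁻¹) := by
    intro k
    refine (hsum k).trans (add_le_add le_rfl (ENNReal.ofReal_le_ofReal ?_))
    rw [← Finset.mul_sum]
    refine mul_le_mul_of_nonneg_left ?_ (by positivity)
    rw [← tsum_geometric_of_lt_one hρ0 hρ1]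
    exact (summable_geometric_of_lt_one hρ0 hρ1).sum_le_tsum _ fun i _ => by positivity
  have hlim : Tendsto (fun k => (𝓕⁻ (s k) : Lp ℂ 2 (volume : Measure (Space N)))) atTop
      (𝓝 (𝓕⁻ w)) :=
    (ContinuousFourierInv.continuous_fourierInv.tendsto w).comp (tendsto_cutoff_ball w)
  obtain ⟨ns, -, hns⟩ := (tendstoInMeasure_of_tendsto_Lp hlim).exists_seq_tendsto_ae
  refine ⟨Lp.aestronglyMeasurable _, ?_⟩
  refine (Lp.eLpNorm_lim_le_liminf_eLpNorm (fun n => Lp.aestronglyMeasurable _) _ hns).trans_lt ?_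
  exact (liminf_le_of_frequently_le' (Frequently.of_forall fun n => hbound (ns n))).trans_lt
    (ENNReal.add_lt_top.2 ⟨hs0, ENNReal.ofReal_lt_top⟩)

end PointInteraction

/-! ### The Green function and its Fourier transform -/

namespace PointInteraction
open FourierTransform

variable {N : ℕ}

/-- The Fourier symbol `1 / (4 π² |ξ|² + lam)` of the resolvent `(lam - Δ)⁻¹`, in the convention
`𝓕 f ξ = ∫ exp(-2πi⟨x, ξ⟩) f x dx`. -/
noncomputable def symbol (N : ℕ) (lam : ℝ) (ξ : Space N) : ℝ :=
  (4 * Real.pi ^ 2 * ‖ξ‖ ^ 2 + lam)⁻¹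

lemma symbol_denom_pos {lam : ℝ} (hlam : 0 < lam) (ξ : Space N) :
    0 < 4 * Real.pi ^ 2 * ‖ξ‖ ^ 2 + lam := by positivity

lemma symbol_pos {lam : ℝ} (hlam : 0 < lam) (ξ : Space N) : 0 < symbol N lam ξ :=
  inv_pos.2 (symbol_denom_pos hlam ξ)

lemma continuous_symbol {lam : ℝ} (hlam : 0 < lam) : Continuous (symbol N lam) :=
  Continuous.inv₀ (by fun_prop) fun ξ => (symbol_denom_pos hlam ξ).ne'

/-- The integrand of `green`. -/
noncomputable def greenIntegrand (N : ℕ) (lam : ℝ) (x : Space N) (t : ℝ) : ℝ :=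
  (4 * Real.pi * t) ^ (-((N : ℝ) / 2)) * Real.exp (-(lam * t) - ‖x‖ ^ 2 / (4 * t))

lemma measurable_greenIntegrand (N : ℕ) (lam : ℝ) :
    Measurable (Function.uncurry (greenIntegrand N lam)) := by
  unfold greenIntegrand Function.uncurry
  fun_prop

lemma greenIntegrand_eq (lam : ℝ) (x : Space N) (t : ℝ) :
    greenIntegrand N lam x t = Real.exp (-(lam * t)) * (4 * Real.pi * t) ^ (-((N : ℝ) / 2)) *
      Real.exp (-(4 * t)⁻¹ * ‖x‖ ^ 2) := by
  rw [greenIntegrand, sub_eq_add_neg, Real.exp_add]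
  ring_nf

lemma integrable_gaussian {b : ℝ} (hb : 0 < b) :
    Integrable (fun x : Space N => Real.exp (-b * ‖x‖ ^ 2)) := by
  have := (GaussianFourier.integrable_cexp_neg_mul_sq_norm_add (V := Space N) (b := (b : ℂ))
    (by simpa using hb) 0 0).norm
  refine this.congr (Eventually.of_forall fun x => ?_)
  simp only [zero_mul, add_zero, Complex.norm_exp]
  norm_cast

lemma integral_greenIntegrand {lam t : ℝ} (ht : 0 < t) :
    ∫ x, greenIntegrand N lam x t = Real.exp (-(lam * t)) := by
  simp only [greenIntegrand_eq]
  rw [integral_const_mul, GaussianFourier.integral_rexp_neg_mul_sq_norm (by positivity)]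
  have e : Real.pi / (4 * t)⁻¹ = 4 * Real.pi * t := by field_simp
  rw [e, finrank_euclideanSpace_fin, mul_assoc, ← Real.rpow_add (by positivity)]
  simp

lemma integrable_greenIntegrand {lam : ℝ} (hlam : 0 < lam) :
    Integrable (Function.uncurry (greenIntegrand N lam))
      (volume.prod (volume.restrict (Ioi (0 : ℝ)))) := by
  rw [integrable_prod_iff' (measurable_greenIntegrand N lam).aestronglyMeasurable]
  have hpos : ∀ t ∈ Ioi (0 : ℝ), ∀ x : Space N, 0 ≤ greenIntegrand N lam x t := by
    intro t ht x
    have : (0 : ℝ) < t := ht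
    unfold greenIntegrand
    positivity
  constructor
  · filter_upwards [ae_restrict_mem measurableSet_Ioi] with t ht
    have : (0 : ℝ) < t := ht
    simp only [Function.uncurry_apply_pair, greenIntegrand_eq]
    exact (integrable_gaussian (by positivity)).const_mul _
  · have h1 := integrableOn_exp_mul_Ioi (a := -lam) (by linarith) 0
    refine h1.congr ?_
    filter_upwards [ae_restrict_mem measurableSet_Ioi] with t ht
    have h2 : ∀ x : Space N, ‖greenIntegrand N lam x t‖ = greenIntegrand N lam x t :=
      fun x => Real.norm_of_nonneg (hpos t ht x)
    simp only [Function.uncurry_apply_pair, h2]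
    rw [integral_greenIntegrand ht, neg_mul]

lemma integrable_green {lam : ℝ} (hlam : 0 < lam) : Integrable (green N lam) :=
  (integrable_greenIntegrand hlam).integral_prod_left

lemma fourier_green {lam : ℝ} (hlam : 0 < lam) (ξ : Space N) :
    𝓕 (fun x : Space N => (green N lam x : ℂ)) ξ = symbol N lam ξ := by
  rw [Real.fourier_eq]
  have e1 : ∀ x : Space N, Real.fourierChar (-inner ℝ x ξ) • (green N lam x : ℂ) =
      ∫ t in Ioi (0 : ℝ), Real.fourierChar (-inner ℝ x ξ) • (greenIntegrand N lam x t : ℂ) := by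
    intro x
    simp only [Circle.smul_def, smul_eq_mul]
    rw [integral_const_mul]
    congr 1
    exact integral_complex_ofReal.symm
  simp only [e1]
  rw [integral_integral_swap]
  · have e2 : ∀ t ∈ Ioi (0 : ℝ),
        ∫ x : Space N, Real.fourierChar (-inner ℝ x ξ) • (greenIntegrand N lam x t : ℂ) =
        ((Real.exp (-(4 * Real.pi ^ 2 * ‖ξ‖ ^ 2 + lam) * t) : ℝ) : ℂ) := by
      intro t ht
      have ht0 : (0 : ℝ) < t := ht
      have hg := fourier_gaussian_innerProductSpace (V := Space N) (b := (((4 * t)⁻¹ : ℝ) : ℂ))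
        (by rw [Complex.ofReal_re]; positivity) ξ
      rw [Real.fourier_eq] at hg
      have e3 : ∀ x : Space N, Real.fourierChar (-inner ℝ x ξ) • (greenIntegrand N lam x t : ℂ) =
          ((Real.exp (-(lam * t)) * (4 * Real.pi * t) ^ (-((N : ℝ) / 2)) : ℝ) : ℂ) *
          (Real.fourierChar (-inner ℝ x ξ) •
            Complex.exp (-(((4 * t)⁻¹ : ℝ) : ℂ) * (‖x‖ : ℂ) ^ 2)) := by
        intro x
        rw [greenIntegrand_eq, mul_smul_comm]
        push_cast
        rfl
      simp only [e3]
      rw [integral_const_mul, hg, finrank_euclideanSpace_fin]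
      have e4 : ((Real.pi : ℂ) / (((4 * t)⁻¹ : ℝ) : ℂ)) ^ ((N : ℂ) / 2) =
          (((4 * Real.pi * t) ^ ((N : ℝ) / 2) : ℝ) : ℂ) := by
        rw [Complex.ofReal_cpow (by positivity)]
        congr 1
        · push_cast
          field_simp
        · push_cast
          rfl
      have e5 : Complex.exp (-(Real.pi : ℂ) ^ 2 * (‖ξ‖ : ℂ) ^ 2 / (((4 * t)⁻¹ : ℝ) : ℂ)) =
          ((Real.exp (-(4 * Real.pi ^ 2 * ‖ξ‖ ^ 2) * t) : ℝ) : ℂ) := by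
        push_cast
        congr 1
        field_simp
      rw [e4, e5, ← Complex.ofReal_mul, ← Complex.ofReal_mul]
      congr 1
      rw [mul_assoc, ← mul_assoc (_ ^ _) (_ ^ _), ← Real.rpow_add (by positivity)]
      simp only [neg_add_cancel, Real.rpow_zero, one_mul]
      rw [← Real.exp_add]
      ring_nf
    rw [setIntegral_congr_fun measurableSet_Ioi e2, integral_complex_ofReal,
      integral_exp_mul_Ioi (by have := symbol_denom_pos hlam ξ; linarith)]
    congr 1
    rw [symbol]
    have := (symbol_denom_pos hlam ξ).ne'
    simp only [mul_zero, Real.exp_zero]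
    field_simp
  · have h1 := (integrable_greenIntegrand (N := N) hlam).ofReal (𝕜 := ℂ)
    refine (integrable_norm_iff ?_).1 (h1.norm.congr (Eventually.of_forall fun p => ?_))
    · have hc : Continuous fun p : Space N × ℝ => Real.fourierChar (-inner ℝ p.1 ξ) := by fun_prop
      exact hc.aestronglyMeasurable.smul h1.1
    · simp [Function.uncurry, Circle.norm_smul]

lemma symbol_le {lam : ℝ} (hlam : 0 < lam) (ξ : Space N) :
    symbol N lam ξ ≤ (min lam 1)⁻¹ * (1 + ‖ξ‖ ^ 2)⁻¹ := by
  rw [symbol, ← mul_inv]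
  have hm : 0 < min lam 1 := lt_min hlam one_pos
  refine inv_anti₀ (by positivity) ?_
  have h1 := min_le_left lam 1
  have h2 := min_le_right lam 1
  have h3 : 1 ≤ 4 * Real.pi ^ 2 := by nlinarith [Real.pi_gt_three]
  have h4 : 0 ≤ ‖ξ‖ ^ 2 := by positivity
  nlinarith

lemma memLp_symbol {lam : ℝ} (hN : N < 4) (hlam : 0 < lam) :
    MemLp (fun ξ : Space N => (symbol N lam ξ : ℂ)) 2 := by
  have hc : Continuous fun ξ : Space N => (symbol N lam ξ : ℂ) :=
    Complex.continuous_ofReal.comp (continuous_symbol hlam)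
  rw [memLp_two_iff_integrable_sq_norm hc.aestronglyMeasurable]
  have h4 := integrable_rpow_neg_one_add_norm_sq (E := Space N) (μ := volume) (r := 4)
    (by rw [finrank_euclideanSpace_fin]; exact_mod_cast hN)
  refine (h4.const_mul ((min lam 1)⁻¹ ^ 2)).mono' (hc.norm.pow 2).aestronglyMeasurable (Eventually.of_forall fun ξ => ?_)
  rw [Real.norm_of_nonneg (by positivity), Complex.norm_real,
    Real.norm_of_nonneg (symbol_pos hlam ξ).le]
  have e : (1 + ‖ξ‖ ^ 2) ^ (-4 / 2 : ℝ) = ((1 + ‖ξ‖ ^ 2)⁻¹) ^ 2 := by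
    rw [show (-4 / 2 : ℝ) = -((2 : ℕ) : ℝ) by norm_num, Real.rpow_neg (by positivity),
      Real.rpow_natCast, inv_pow]
  rw [e, ← mul_pow]
  have := symbol_pos hlam ξ
  gcongr
  exact symbol_le hlam ξ

/-- The symbol as an element of `L²`. -/
noncomputable def symbolLp (hN : N < 4) {lam : ℝ} (hlam : 0 < lam) :
    Lp ℂ 2 (volume : Measure (Space N)) := (memLp_symbol hN hlam).toLp _

/-- In dimension `N < 4` the Green function is the `L²` inverse Fourier transform of its symbol. -/
lemma fourierInv_symbolLp_ae_eq (hN : N < 4) {lam : ℝ} (hlam : 0 < lam) :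
    (𝓕⁻ (symbolLp hN hlam) : Lp ℂ 2 (volume : Measure (Space N))) =ᵐ[volume]
      fun x => (green N lam x : ℂ) := by
  have e : 𝓕 (fun x : Space N => (green N lam x : ℂ)) = fun ξ => (symbol N lam ξ : ℂ) :=
    funext (fourier_green hlam)
  have h : MemLp (𝓕 (fun x : Space N => (green N lam x : ℂ))) 2 := e ▸ memLp_symbol hN hlam
  have hint : Integrable (fun x : Space N => (green N lam x : ℂ)) := (integrable_green hlam).ofReal
  have h2 := ae_eq_fourierInv_of_memLp_fourier hint h
  have e2 : h.toLp _ = symbolLp hN hlam := by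
    unfold symbolLp
    congr 1
  rwa [e2] at h2

lemma memLp_two_green (hN : N < 4) {lam : ℝ} (hlam : 0 < lam) :
    MemLp (fun x : Space N => (green N lam x : ℂ)) 2 :=
  (memLp_congr_ae (fourierInv_symbolLp_ae_eq hN hlam)).1 (Lp.memLp _)

lemma norm_cutoff_symbolLp_le (hN : N < 4) {lam : ℝ} (hlam : 0 < lam) (k : ℕ) :
    ‖cutoff (Metric.ball 0 (2 ^ (k + 1)) \ Metric.ball 0 (2 ^ k))
      (measurableSet_ball.diff measurableSet_ball) (symbolLp hN hlam)‖ ≤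
    (2 ^ N * volume.real (Metric.ball (0 : Space N) 1)) ^ (1 / 2 : ℝ) *
      (2 ^ (-(2 - (N : ℝ) / 2))) ^ k := by
  set V := volume.real (Metric.ball (0 : Space N) 1) with hV
  have hV0 : 0 ≤ V := measureReal_nonneg
  set s := Metric.ball (0 : Space N) (2 ^ (k + 1)) \ Metric.ball 0 (2 ^ k) with hs
  have hsm : MeasurableSet s := measurableSet_ball.diff measurableSet_ball
  refine ENNReal.toReal_le_of_le_ofReal (by positivity) ?_
  rw [eLpNorm_congr_ae (coeFn_cutoff hsm _), eLpNorm_indicator_eq_eLpNorm_restrict hsm]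
  have h1 : ∀ᵐ ξ ∂(volume.restrict s), ‖symbolLp hN hlam ξ‖ ≤ ((2 : ℝ) ^ (2 * k))⁻¹ := by
    filter_upwards [ae_restrict_of_ae (memLp_symbol hN hlam).coeFn_toLp,
      ae_restrict_mem hsm] with ξ h1 h2
    rw [symbolLp, h1, Complex.norm_real, Real.norm_of_nonneg (symbol_pos hlam ξ).le, symbol]
    refine inv_anti₀ (by positivity) ?_
    have h3 : (2 : ℝ) ^ k ≤ ‖ξ‖ := by simpa using h2.2
    have h4 : (2 : ℝ) ^ (2 * k) ≤ ‖ξ‖ ^ 2 := by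
      rw [mul_comm, pow_mul]
      gcongr
    have h5 : 1 ≤ 4 * Real.pi ^ 2 := by nlinarith [Real.pi_gt_three]
    nlinarith [sq_nonneg ‖ξ‖]
  refine (eLpNorm_le_of_ae_bound h1).trans ?_
  have h2 : (volume.restrict s) univ ≤ ENNReal.ofReal ((2 ^ (k + 1)) ^ N * V) := by
    rw [Measure.restrict_apply_univ, ENNReal.ofReal_mul (by positivity), hV,
      ofReal_measureReal measure_ball_lt_top.ne]
    refine (measure_mono sdiff_subset).trans (le_of_eq ?_)
    rw [Measure.addHaar_ball_of_pos _ _ (by positivity)]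
    simp
  calc _ ≤ ENNReal.ofReal ((2 ^ (k + 1)) ^ N * V) ^ ((2 : ℝ≥0∞).toReal⁻¹) *
        ENNReal.ofReal (((2 : ℝ) ^ (2 * k))⁻¹) := by gcongr
    _ = _ := by
      rw [ENNReal.ofReal_rpow_of_nonneg (by positivity) (by positivity),
        ← ENNReal.ofReal_mul (by positivity)]
      congr 1
      have e1 : ((2 : ℝ) ^ (k + 1)) ^ N * V = 2 ^ N * V * (2 ^ k) ^ N := by
        rw [pow_succ, mul_pow]
        ring
      have e2 : (((2 : ℝ) ^ k) ^ N) ^ (1 / 2 : ℝ) * (2 ^ (2 * k))⁻¹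
          = (2 ^ (-(2 - (N : ℝ) / 2))) ^ k := by
        rw [← pow_mul, ← Real.rpow_natCast_mul two_pos.le, ← Real.rpow_natCast 2 (2 * k),
          ← Real.rpow_neg two_pos.le, ← Real.rpow_add two_pos, ← Real.rpow_mul_natCast two_pos.le]
        congr 1
        push_cast
        ring
      rw [e1, ENNReal.toReal_ofNat, ← one_div, Real.mul_rpow (by positivity) (by positivity),
        mul_assoc, e2]

/-- The Green function is in `L^q` for `2 ≤ q < 3` in dimension `3`, and for all `q ≥ 2` in lower
dimensions. -/
lemma memLp_green_of_two_le (hN : N < 4) {lam q : ℝ} (hlam : 0 < lam) (hq : 2 ≤ q)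
    (hNq : (N : ℝ) / 2 * (1 - 2 / q) < 2 - (N : ℝ) / 2) :
    MemLp (fun x : Space N => (green N lam x : ℂ)) (ENNReal.ofReal q) :=
  (memLp_congr_ae (fourierInv_symbolLp_ae_eq hN hlam)).1
    (memLp_fourierInv_of_dyadic_decay hq (by positivity) hNq _ (norm_cutoff_symbolLp_le hN hlam))

lemma memLp_of_memLp_one_of_memLp_two {Y : Type*} [MeasurableSpace Y] {μ : Measure Y} {f : Y → ℂ}
    (h1 : MemLp f 1 μ) (h2 : MemLp f 2 μ) {r : ℝ} (hr1 : 1 ≤ r) (hr2 : r ≤ 2) :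
    MemLp f (ENNReal.ofReal r) μ := by
  have hr0 : 0 < r := by linarith
  refine ⟨h1.1, ?_⟩
  rw [eLpNorm_lt_top_iff_lintegral_rpow_enorm_lt_top (by simpa using hr0) ENNReal.ofReal_ne_top,
    ENNReal.toReal_ofReal hr0.le]
  have i1 := lintegral_rpow_enorm_lt_top_of_eLpNorm_lt_top (by norm_num) (by norm_num) h1.2
  have i2 := lintegral_rpow_enorm_lt_top_of_eLpNorm_lt_top (by norm_num) (by norm_num) h2.2
  refine lt_of_le_of_lt ?_ (ENNReal.add_lt_top.2 ⟨i1, i2⟩)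
  rw [← lintegral_add_left' (h1.1.enorm.pow_const _)]
  refine lintegral_mono fun x => ?_
  simp only [ENNReal.toReal_one, ENNReal.toReal_ofNat]
  rcases le_total ‖f x‖ₑ 1 with h | h
  · exact (ENNReal.rpow_le_rpow_of_exponent_ge h hr1).trans le_self_add
  · exact (ENNReal.rpow_le_rpow_of_exponent_le h hr2).trans le_add_self

lemma memLp_green_of_le_two (hN : N < 4) {lam r : ℝ} (hlam : 0 < lam) (hr1 : 1 ≤ r) (hr2 : r ≤ 2) :
    MemLp (fun x : Space N => (green N lam x : ℂ)) (ENNReal.ofReal r) :=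
  memLp_of_memLp_one_of_memLp_two (memLp_one_iff_integrable.2 (integrable_green hlam).ofReal)
    (memLp_two_green hN hlam) hr1 hr2

/-- Parseval's identity for two Green functions. -/
lemma integral_green_mul_green (hN : N < 4) {l m : ℝ} (hl : 0 < l) (hm : 0 < m) :
    ∫ x : Space N, green N l x * green N m x = ∫ ξ : Space N, symbol N l ξ * symbol N m ξ := by
  have h : inner ℂ (𝓕⁻ (symbolLp hN hl)) (𝓕⁻ (symbolLp hN hm)) =
      inner ℂ (symbolLp hN hl) (symbolLp hN hm) := by
    rw [← Lp.inner_fourier_eq, fourier_fourierInv_eq, fourier_fourierInv_eq]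
  rw [L2.inner_def, L2.inner_def] at h
  have e1 : ∫ x, inner ℂ ((𝓕⁻ (symbolLp hN hl) : Lp ℂ 2 (volume : Measure (Space N))) x)
      ((𝓕⁻ (symbolLp hN hm) : Lp ℂ 2 (volume : Measure (Space N))) x)
      = ∫ x : Space N, ((green N l x * green N m x : ℝ) : ℂ) := by
    refine integral_congr_ae ?_
    filter_upwards [fourierInv_symbolLp_ae_eq hN hl, fourierInv_symbolLp_ae_eq hN hm]
      with x h1 h2
    rw [h1, h2]
    simp [mul_comm]
  have e2 : ∫ x, inner ℂ (symbolLp hN hl x) (symbolLp hN hm x)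
      = ∫ x : Space N, ((symbol N l x * symbol N m x : ℝ) : ℂ) := by
    refine integral_congr_ae ?_
    filter_upwards [(memLp_symbol hN hl).coeFn_toLp, (memLp_symbol hN hm).coeFn_toLp]
      with x h1 h2
    rw [symbolLp, symbolLp, h1, h2]
    simp [mul_comm]
  rw [e1, e2, integral_complex_ofReal, integral_complex_ofReal] at h
  exact_mod_cast h

end PointInteraction

/-! ### Explicit integrals of symbols -/

namespace PointInteraction

lemma tendsto_mul_sq_add {A : ℝ} (hA : 0 < A) (l : ℝ) :
    Tendsto (fun y : ℝ => A * y ^ 2 + l) atTop atTop :=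
  tendsto_atTop_add_const_right _ _ ((tendsto_pow_atTop two_ne_zero).const_mul_atTop hA)

lemma integral_symbols_radial_two {A l m : ℝ} (hA : 0 < A) (hl : 0 < l) (hm : 0 < m) (h : m < l) :
    ∫ y in Ioi (0 : ℝ), y * ((A * y ^ 2 + l)⁻¹ * (A * y ^ 2 + m)⁻¹) =
      (Real.log l - Real.log m) / (2 * A * (l - m)) := by
  have hlm : l - m ≠ 0 := (sub_pos.2 h).ne'
  have hd : ∀ x ∈ Ici (0 : ℝ), HasDerivAt
      (fun y => (Real.log (A * y ^ 2 + m) - Real.log (A * y ^ 2 + l)) / (2 * A * (l - m)))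
      (x * ((A * x ^ 2 + l)⁻¹ * (A * x ^ 2 + m)⁻¹)) x := by
    intro x _
    have hx1 : A * x ^ 2 + l ≠ 0 := by positivity
    have hx2 : A * x ^ 2 + m ≠ 0 := by positivity
    have p : ∀ c : ℝ, HasDerivAt (fun y : ℝ => A * y ^ 2 + c) (A * (2 * x)) x := fun c => by
      simpa using ((hasDerivAt_pow 2 x).const_mul A).add_const c
    have := (((p m).log hx2).sub ((p l).log hx1)).div_const (2 * A * (l - m))
    refine this.congr_deriv ?_
    field_simp
    ring
  have hlim : Tendsto
      (fun y => (Real.log (A * y ^ 2 + m) - Real.log (A * y ^ 2 + l)) / (2 * A * (l - m)))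
      atTop (𝓝 0) := by
    have h1 : Tendsto (fun y : ℝ => 1 + (m - l) / (A * y ^ 2 + l)) atTop (𝓝 (1 + 0)) :=
      ((tendsto_mul_sq_add hA l).const_div_atTop _).const_add _
    rw [add_zero] at h1
    have h2 := (h1.log one_ne_zero).div_const (2 * A * (l - m))
    rw [Real.log_one, zero_div] at h2
    refine h2.congr fun y => ?_
    have hx1 : A * y ^ 2 + l ≠ 0 := by positivity
    have hx2 : A * y ^ 2 + m ≠ 0 := by positivity
    rw [← Real.log_div hx2 hx1]
    congr 2
    field_simp
    ring
  rw [integral_Ioi_of_hasDerivAt_of_nonneg' hd (fun x hx => ?_) hlim]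
  · simp only [ne_eq, OfNat.ofNat_ne_zero, not_false_eq_true, zero_pow, mul_zero, zero_add]
    ring
  · have : (0 : ℝ) < x := hx
    positivity

lemma integral_symbols_radial_three {l m : ℝ} (hl : 0 < l) (hm : 0 < m) (h : m < l) :
    ∫ y in Ioi (0 : ℝ), y ^ 2 *
      ((4 * Real.pi ^ 2 * y ^ 2 + l)⁻¹ * (4 * Real.pi ^ 2 * y ^ 2 + m)⁻¹) =
      (√l - √m) / (16 * Real.pi ^ 2 * (l - m)) := by
  have hlm : l - m ≠ 0 := (sub_pos.2 h).ne'
  have hpi := Real.pi_pos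
  have hd1 : ∀ c : ℝ, 0 < c → ∀ x : ℝ, HasDerivAt
      (fun y => √c / (2 * Real.pi) * Real.arctan (2 * Real.pi / √c * y))
      (c / (4 * Real.pi ^ 2 * x ^ 2 + c)) x := by
    intro c hc x
    have hs : 0 < √c := Real.sqrt_pos.2 hc
    have h1 : HasDerivAt (fun y : ℝ => 2 * Real.pi / √c * y) (2 * Real.pi / √c) x := by
      simpa using (hasDerivAt_id x).const_mul (2 * Real.pi / √c)
    refine (h1.arctan.const_mul (√c / (2 * Real.pi))).congr_deriv ?_
    have h2 : c = √c ^ 2 := (Real.sq_sqrt hc.le).symm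
    have h3 : 1 + (2 * Real.pi / √c * x) ^ 2 = (4 * Real.pi ^ 2 * x ^ 2 + c) / c := by
      rw [mul_pow, div_pow, Real.sq_sqrt hc.le]
      field_simp
      ring
    rw [h3]
    field_simp
  have hd : ∀ x ∈ Ici (0 : ℝ), HasDerivAt
      (fun y => (√l / (2 * Real.pi) * Real.arctan (2 * Real.pi / √l * y)
        - √m / (2 * Real.pi) * Real.arctan (2 * Real.pi / √m * y)) / (4 * Real.pi ^ 2 * (l - m)))
      (x ^ 2 * ((4 * Real.pi ^ 2 * x ^ 2 + l)⁻¹ * (4 * Real.pi ^ 2 * x ^ 2 + m)⁻¹)) x := by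
    intro x _
    refine (((hd1 l hl x).sub (hd1 m hm x)).div_const _).congr_deriv ?_
    have hx1 : 4 * Real.pi ^ 2 * x ^ 2 + l ≠ 0 := by positivity
    have hx2 : 4 * Real.pi ^ 2 * x ^ 2 + m ≠ 0 := by positivity
    field_simp
    ring
  have hlim1 : ∀ c : ℝ, 0 < c → Tendsto
      (fun y => √c / (2 * Real.pi) * Real.arctan (2 * Real.pi / √c * y)) atTop
      (𝓝 (√c / (2 * Real.pi) * (Real.pi / 2))) := by
    intro c hc
    have hs : 0 < √c := Real.sqrt_pos.2 hc
    exact ((tendsto_nhds_of_tendsto_nhdsWithin Real.tendsto_arctan_atTop).comp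
      (tendsto_id.const_mul_atTop (by positivity : 0 < 2 * Real.pi / √c))).const_mul _
  rw [integral_Ioi_of_hasDerivAt_of_nonneg' hd (fun x hx => ?_)
    (((hlim1 l hl).sub (hlim1 m hm)).div_const _)]
  · simp only [mul_zero, Real.arctan_zero, sub_zero, zero_div]
    field_simp
    ring
  · have : (0 : ℝ) < x := hx
    positivity

lemma beta_sub_two {l m : ℝ} (hl : 0 < l) (hm : 0 < m) :
    beta 2 l - beta 2 m = (Real.log l - Real.log m) / (4 * Real.pi) := by
  have h : ∀ c : ℝ, 0 < c → Real.log (√c / 2) = Real.log c / 2 - Real.log 2 := fun c hc => by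
    rw [Real.log_div (Real.sqrt_pos.2 hc).ne' two_ne_zero, Real.log_sqrt hc.le]
  simp only [beta, if_true, h l hl, h m hm]
  field_simp
  ring

/-- The function `β` is, up to a constant, a renormalized value of the Green function at the
origin: `β(l) - β(m) = (l - m) ∫ 1 / ((4π²|ξ|² + l) (4π²|ξ|² + m)) dξ`. -/
lemma mul_integral_symbols {N : ℕ} (hN : N = 2 ∨ N = 3) {l m : ℝ} (hl : 0 < l) (hm : 0 < m) :
    (l - m) * ∫ ξ : Space N, symbol N l ξ * symbol N m ξ = beta N l - beta N m := by
  wlog h : m < l generalizing l m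
  · rcases eq_or_lt_of_le (not_lt.1 h) with rfl | h'
    · simp
    · have := this hm hl h'
      simp only [mul_comm (symbol N l _)]
      linarith
  have hlm : l - m ≠ 0 := (sub_pos.2 h).ne'
  have hpi := Real.pi_pos
  rcases hN with rfl | rfl
  · have e := integral_fun_norm_addHaar (volume : Measure (Space 2))
      (fun y => (4 * Real.pi ^ 2 * y ^ 2 + l)⁻¹ * (4 * Real.pi ^ 2 * y ^ 2 + m)⁻¹)
    simp only [finrank_euclideanSpace_fin, Measure.real, EuclideanSpace.volume_ball_fin_two,
      smul_eq_mul, Nat.add_one_sub_one, pow_one, nsmul_eq_mul,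
      integral_symbols_radial_two (by positivity : 0 < 4 * Real.pi ^ 2) hl hm h] at e
    simp only [symbol]
    rw [e, beta_sub_two hl hm]
    simp [Real.pi_pos.le]
    field_simp
  · have e := integral_fun_norm_addHaar (volume : Measure (Space 3))
      (fun y => (4 * Real.pi ^ 2 * y ^ 2 + l)⁻¹ * (4 * Real.pi ^ 2 * y ^ 2 + m)⁻¹)
    simp only [finrank_euclideanSpace_fin, Measure.real, EuclideanSpace.volume_ball_fin_three,
      smul_eq_mul, Nat.add_one_sub_one, nsmul_eq_mul,
      integral_symbols_radial_three hl hm h] at e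
    simp only [symbol]
    rw [e]
    simp [beta, ENNReal.toReal_ofReal (by positivity : 0 ≤ Real.pi * 4 / 3)]
    field_simp
    ring

lemma integrable_symbol_mul_symbol {N : ℕ} (hN : N < 4) {l m : ℝ} (hl : 0 < l) (hm : 0 < m) :
    Integrable fun ξ : Space N => symbol N l ξ * symbol N m ξ := by
  have h := (memLp_symbol (N := N) hN hl).integrable_mul (memLp_symbol hN hm)
  refine h.re.congr (Eventually.of_forall fun ξ => ?_)
  simp

lemma integral_symbol_sq_pos {N : ℕ} (hN : N < 4) {l : ℝ} (hl : 0 < l) :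
    0 < ∫ ξ : Space N, symbol N l ξ * symbol N l ξ := by
  refine (integral_pos_iff_support_of_nonneg (fun ξ => by have := symbol_pos hl ξ; positivity)
    (integrable_symbol_mul_symbol hN hl hl)).2 ?_
  have : Function.support (fun ξ : Space N => symbol N l ξ * symbol N l ξ) = univ := by
    ext ξ
    simp [(symbol_pos hl ξ).ne']
  rw [this]
  exact isOpen_univ.measure_pos _ univ_nonempty

lemma omegaMax_pos {N : ℕ} (hN : N = 2 ∨ N = 3) {α : ℝ} (hα : N = 3 → α < 0) :
    0 < omegaMax N α := by
  rw [omegaMax, abs_pos, eigenvalue]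
  rcases hN with rfl | rfl
  · simp
  · have := hα rfl
    simp [this.ne, Real.pi_ne_zero]

lemma alpha_add_beta_omegaMax {N : ℕ} (hN : N = 2 ∨ N = 3) {α : ℝ} (hα : N = 3 → α < 0) :
    α + beta N (omegaMax N α) = 0 := by
  have hpi := Real.pi_pos
  rcases hN with rfl | rfl
  · have e : omegaMax 2 α = 4 * Real.exp (-(4 * Real.pi * α) - 2 * Real.eulerMascheroniConstant) := by
      rw [omegaMax, eigenvalue, if_pos rfl, abs_neg, abs_of_pos (by positivity)]
    have h2 : Real.log (√(omegaMax 2 α) / 2)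
        = -(2 * Real.pi * α) - Real.eulerMascheroniConstant := by
      rw [Real.log_div (by rw [e]; positivity) two_ne_zero, Real.log_sqrt (by rw [e]; positivity),
        e, Real.log_mul four_ne_zero (Real.exp_ne_zero _), Real.log_exp,
        show (4 : ℝ) = 2 ^ 2 by norm_num, Real.log_pow]
      push_cast
      ring
    rw [beta, if_pos rfl, h2]
    field_simp
    ring
  · have hα' := hα rfl
    have e : omegaMax 3 α = (-(4 * Real.pi * α)) ^ 2 := by
      rw [omegaMax, eigenvalue, if_neg (by norm_num), abs_neg, abs_of_nonneg (by positivity), neg_sq]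
    rw [beta, if_neg (by norm_num), e, Real.sqrt_sq (by nlinarith)]
    field_simp
    ring

/-- The Green function has no square-integrable gradient, in Fourier variables. The factor
`1 / (4π²|ξ|² + 1)` replaces one of the two symbols for later use. -/
lemma not_integrable_sq_mul_symbols {N : ℕ} (hN : 2 ≤ N) {l : ℝ} (hl : 0 < l) :
    ¬ Integrable fun ξ : Space N =>
      4 * Real.pi ^ 2 * ‖ξ‖ ^ 2 * (symbol N l ξ * symbol N 1 ξ) := by
  have : Nonempty (Fin N) := ⟨⟨0, by omega⟩⟩
  have hpi := Real.pi_pos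
  set A := 4 * Real.pi ^ 2 with hA
  have hA0 : 0 < A := by positivity
  have e := integrable_fun_norm_addHaar (volume : Measure (Space N))
    (f := fun y => A * y ^ 2 * ((A * y ^ 2 + l)⁻¹ * (A * y ^ 2 + 1)⁻¹))
  simp only [symbol, ← hA]
  rw [e]
  intro h
  refine not_integrableOn_Ioi_inv (a := 1) ?_
  have h1 := (h.mono_set (Ioi_subset_Ioi zero_le_one)).const_mul ((A + l) * (A + 1) / A)
  refine Integrable.mono' h1 measurable_inv.aestronglyMeasurable ?_
  filter_upwards [ae_restrict_mem measurableSet_Ioi] with y hy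
  have hy1 : (1 : ℝ) < y := hy
  have hy0 : 0 < y := by linarith
  rw [Real.norm_of_nonneg (by positivity), finrank_euclideanSpace_fin, smul_eq_mul]
  have h2 : y ≤ y ^ (N - 1) := le_self_pow₀ hy1.le (by omega)
  have hy2 : 1 ≤ y ^ 2 := one_le_pow₀ hy1.le
  have h3 : (A + l) * y ^ 2 ≥ A * y ^ 2 + l := by nlinarith
  have h4 : (A + 1) * y ^ 2 ≥ A * y ^ 2 + 1 := by nlinarith
  calc y⁻¹ = (A + l) * (A + 1) / A *
        (y * (A * y ^ 2 * (((A + l) * y ^ 2)⁻¹ * ((A + 1) * y ^ 2)⁻¹))) := by field_simp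
    _ ≤ _ := by gcongr

lemma exists_ball_integral_large {N : ℕ} (hN : 2 ≤ N) {l : ℝ} (hl : 0 < l) (K : ℝ) :
    ∃ R : ℕ, K < ∫ ξ in Metric.ball (0 : Space N) R,
      4 * Real.pi ^ 2 * ‖ξ‖ ^ 2 * (symbol N l ξ * symbol N 1 ξ) := by
  by_contra! hcon
  refine not_integrable_sq_mul_symbols hN hl ?_
  have hc : Continuous fun ξ : Space N =>
      4 * Real.pi ^ 2 * ‖ξ‖ ^ 2 * (symbol N l ξ * symbol N 1 ξ) :=
    (by fun_prop : Continuous fun ξ : Space N => 4 * Real.pi ^ 2 * ‖ξ‖ ^ 2).mul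
      ((continuous_symbol hl).mul (continuous_symbol one_pos))
  refine (aecover_ball (μ := volume) (x := (0 : Space N))
    tendsto_natCast_atTop_atTop).integrable_of_integral_norm_bounded K (fun R => ?_)
    (Eventually.of_forall fun R => ?_)
  · exact (hc.continuousOn.integrableOn_compact (isCompact_closedBall (0 : Space N) R)).mono_set
      Metric.ball_subset_closedBall
  · refine le_trans (le_of_eq (integral_congr_ae (Eventually.of_forall fun ξ => ?_))) (hcon R)
    have h1 := symbol_pos hl ξ
    have h2 := symbol_pos one_pos ξ
    exact Real.norm_of_nonneg (by positivity)

end PointInteraction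

/-! ### Control of the charge -/

namespace PointInteraction
open FourierTransform

variable {N : ℕ}

/-- The coordinate vector `e_i` of `ℝ^N`. -/
noncomputable abbrev basisVec (i : Fin N) : Space N := EuclideanSpace.single i (1 : ℝ)

lemma inner_basisVec (ξ : Space N) (i : Fin N) : inner ℝ ξ (basisVec i) = ξ i := by
  simp [basisVec, EuclideanSpace.inner_single_right]

lemma norm_integral_mul_le {Y : Type*} [MeasurableSpace Y] {μ : Measure Y} {p q : ℝ≥0∞}
    [Fact (1 ≤ p)] [Fact (1 ≤ q)] [ENNReal.HolderConjugate p q] (f : Lp ℂ p μ) (g : Lp ℂ q μ) :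
    ‖∫ x, f x * g x ∂μ‖ ≤ ‖f‖ * ‖g‖ := by
  have h1 : ∫ x, f x * g x ∂μ = ∫ x, (ContinuousLinearMap.mul ℂ ℂ).holder 1 f g x ∂μ :=
    integral_congr_ae (by
      filter_upwards [(ContinuousLinearMap.mul ℂ ℂ).coeFn_holder (r := 1) f g] with x hx
      rw [hx]
      rfl)
  rw [h1]
  refine (norm_integral_le_integral_norm _).trans ?_
  rw [← L1.norm_eq_integral_norm]
  refine ((ContinuousLinearMap.mul ℂ ℂ).norm_holder_apply_apply_le f g).trans ?_
  have := ContinuousLinearMap.opNorm_mul_le ℂ ℂ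
  calc _ ≤ 1 * ‖f‖ * ‖g‖ := by gcongr
    _ = _ := by ring

lemma norm_integral_schwartz_mul_le {q : ℝ≥0∞} {r : ℝ≥0∞}
    [Fact (1 ≤ r)] [Fact (1 ≤ q)] [ENNReal.HolderConjugate r q] (φ : 𝓢(Space N, ℂ))
    (g : Lp ℂ q (volume : Measure (Space N))) :
    ‖∫ x, φ x * g x‖ ≤ ‖φ.toLp r volume‖ * ‖g‖ := by
  refine le_trans (le_of_eq ?_) (norm_integral_mul_le (φ.toLp r volume) g)
  congr 1
  refine integral_congr_ae ?_
  filter_upwards [φ.coeFn_toLp r volume] with x hx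
  rw [hx]

/-- The Schwartz function `ξ ↦ -2πi ξ_i χ(ξ)`, whose Fourier transform is `∂_i 𝓕 χ`. -/
noncomputable def mulCoord (i : Fin N) (χ : 𝓢(Space N, ℂ)) : 𝓢(Space N, ℂ) :=
  -(2 * Real.pi * Complex.I) • SchwartzMap.smulLeftCLM ℂ (inner ℝ · (basisVec i)) χ

lemma mulCoord_apply (i : Fin N) (χ : 𝓢(Space N, ℂ)) (ξ : Space N) :
    mulCoord i χ ξ = -(2 * Real.pi * Complex.I) * (ξ i * χ ξ) := by
  have : (fun ξ : Space N => inner ℝ ξ (basisVec i)).HasTemperateGrowth := by fun_prop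
  rw [mulCoord, smul_apply, SchwartzMap.smulLeftCLM_apply_apply this, inner_basisVec,
    Complex.real_smul, smul_eq_mul]

lemma lineDeriv_fourier_schwartz (i : Fin N) (χ : 𝓢(Space N, ℂ)) :
    ∂_{basisVec i} (𝓕 χ) = 𝓕 (mulCoord i χ) :=
  SchwartzMap.lineDerivOp_fourier_eq χ _

lemma sum_mulCoord_mulCoord (χ : 𝓢(Space N, ℂ)) (ξ : Space N) :
    ∑ i, mulCoord i (mulCoord i χ) ξ = -((4 * Real.pi ^ 2 * ‖ξ‖ ^ 2 : ℝ) * χ ξ) := by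
  simp only [mulCoord_apply]
  have e : ∀ i, -(2 * (Real.pi : ℂ) * Complex.I) * ((ξ i : ℂ) *
      (-(2 * (Real.pi : ℂ) * Complex.I) * ((ξ i : ℂ) * χ ξ))) =
      ((ξ i ^ 2 : ℝ) : ℂ) * (-(4 * (Real.pi : ℂ) ^ 2) * χ ξ) := by
    intro i
    push_cast
    linear_combination (4 * (Real.pi : ℂ) ^ 2 * (ξ i : ℂ) ^ 2 * χ ξ) * Complex.I_sq
  simp only [e]
  rw [← Finset.sum_mul, ← Complex.ofReal_sum]
  have e2 : ∑ i, ξ i ^ 2 = ‖ξ‖ ^ 2 := by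
    rw [EuclideanSpace.norm_sq_eq]
    simp
  rw [e2]
  push_cast
  ring

lemma integral_schwartz_weakDeriv {q : ℝ≥0∞} [Fact (1 ≤ q)] (g : regularSpace N q) (i : Fin N)
    (φ : 𝓢(Space N, ℂ)) :
    ∫ x, φ x * g.1.2 i x = -∫ x, (∂_{basisVec i} φ) x * g.1.1 x := by
  have h := DFunLike.congr_fun (g.2 i) φ
  rw [TemperedDistribution.lineDerivOp_apply_apply, Lp.toTemperedDistribution_apply,
    Lp.toTemperedDistribution_apply] at h
  simp only [smul_eq_mul, neg_apply, neg_mul] at h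
  rw [← h, integral_neg]

/-- Integration by parts against the Laplacian of `𝓕 χ`. -/
lemma integral_laplacian_test {q : ℝ≥0∞} [Fact (1 ≤ q)] (g : regularSpace N q)
    (χ : 𝓢(Space N, ℂ)) :
    ∫ x, (∑ i, 𝓕 (mulCoord i (mulCoord i χ))) x * g.1.1 x =
      -∑ i, ∫ x, 𝓕 (mulCoord i χ) x * g.1.2 i x := by
  have := ENNReal.HolderConjugate.inv_one_sub_inv' (Fact.out : 1 ≤ q)
  have hint : ∀ φ : 𝓢(Space N, ℂ), Integrable fun x => φ x * g.1.1 x := fun φ =>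
    (φ.memLp (1 - q⁻¹)⁻¹ volume).integrable_mul (Lp.memLp g.1.1)
  simp only [sum_apply, Finset.sum_mul]
  rw [integral_finsetSum _ fun i _ => hint _, ← Finset.sum_neg_distrib]
  refine Finset.sum_congr rfl fun i _ => ?_
  rw [integral_schwartz_weakDeriv, lineDeriv_fourier_schwartz, neg_neg]

lemma integral_fourier_mul_green (hN : N < 4) {lam : ℝ} (hlam : 0 < lam) (χ : 𝓢(Space N, ℂ)) :
    ∫ x, 𝓕 χ x * (green N lam x : ℂ) = ∫ ξ, χ ξ * (symbol N lam ξ : ℂ) := by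
  have h := integral_schwartz_smul_Lp_fourierInv (symbolLp hN hlam) (𝓕 χ)
  rw [fourierInv_fourier_eq] at h
  refine Eq.trans (integral_congr_ae ?_) (h.trans (integral_congr_ae ?_))
  · filter_upwards [fourierInv_symbolLp_ae_eq hN hlam] with x hx
    rw [hx, smul_eq_mul]
  · filter_upwards [(memLp_symbol hN hlam).coeFn_toLp] with x hx
    rw [symbolLp, hx, smul_eq_mul]

/-- Test functions which see the singularity of the Green function at a small cost in the norm of
the gradient: `𝓕 χ` is a smoothly truncated Green function, so that both `‖∇ 𝓕 χ‖²` and the pairing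
of its Laplacian with the Green function are comparable to the same divergent integral. -/
lemma exists_charge_test (hN2 : 2 ≤ N) {lam ε : ℝ} (hlam : 0 < lam) (hε : 0 < ε) :
    ∃ (χ : 𝓢(Space N, ℂ)) (J : ℝ), 0 < J ∧
      ∫ ξ, (∑ i, mulCoord i (mulCoord i χ)) ξ * (symbol N lam ξ : ℂ) = ((-J : ℝ) : ℂ) ∧
      ∀ i, ‖(mulCoord i χ).toLp 2 volume‖ ≤ ε * J := by
  have hm : 0 < max 1 lam := lt_max_of_lt_left one_pos
  obtain ⟨R, hR⟩ := exists_ball_integral_large hN2 hlam (max 1 lam / ε ^ 2)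
  have hpi := Real.pi_pos
  let b : ContDiffBump (0 : Space N) := ⟨R + 1, R + 2, by positivity, by linarith⟩
  have hsm : ContDiff ℝ ((⊤ : ℕ∞) : WithTop ℕ∞)
      (fun ξ : Space N => ((b ξ * symbol N 1 ξ : ℝ) : ℂ)) := by
    refine Complex.ofRealCLM.contDiff.comp (b.contDiff.mul ?_)
    unfold symbol
    exact ContDiff.inv ((contDiff_const.mul (contDiff_norm_sq ℝ)).add contDiff_const) fun ξ => (symbol_denom_pos one_pos ξ).ne'
  have hcs : HasCompactSupport (fun ξ : Space N => ((b ξ * symbol N 1 ξ : ℝ) : ℂ)) := by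
    refine (b.hasCompactSupport.mul_right (f' := symbol N 1)).comp_left (g := Complex.ofReal) ?_
    simp
  set χ : 𝓢(Space N, ℂ) := hcs.toSchwartzMap hsm with hχ
  have hχ_apply : ∀ ξ, χ ξ = ((b ξ * symbol N 1 ξ : ℝ) : ℂ) := fun ξ => rfl
  set F : Space N → ℝ := fun ξ => b ξ * (4 * Real.pi ^ 2 * ‖ξ‖ ^ 2 *
    (symbol N lam ξ * symbol N 1 ξ)) with hF
  have hc : Continuous fun ξ : Space N =>
      4 * Real.pi ^ 2 * ‖ξ‖ ^ 2 * (symbol N lam ξ * symbol N 1 ξ) :=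
    (by fun_prop : Continuous fun ξ : Space N => 4 * Real.pi ^ 2 * ‖ξ‖ ^ 2).mul
      ((continuous_symbol hlam).mul (continuous_symbol one_pos))
  have hw0 : ∀ ξ : Space N, 0 ≤ 4 * Real.pi ^ 2 * ‖ξ‖ ^ 2 * (symbol N lam ξ * symbol N 1 ξ) := by
    intro ξ
    have h1 := symbol_pos hlam ξ
    have h2 := symbol_pos one_pos ξ
    positivity
  have hFint : Integrable F :=
    (b.continuous.mul hc).integrable_of_hasCompactSupport b.hasCompactSupport.mul_right
  have hF0 : ∀ ξ, 0 ≤ F ξ := fun ξ => mul_nonneg b.nonneg (hw0 ξ)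
  have hJ : max 1 lam / ε ^ 2 < ∫ ξ, F ξ := by
    refine hR.trans_le ?_
    refine le_trans (le_of_eq ?_)
      (setIntegral_le_integral (s := Metric.ball (0 : Space N) R) hFint
        (Eventually.of_forall hF0))
    refine setIntegral_congr_fun measurableSet_ball fun ξ hξ => ?_
    have : b ξ = 1 := b.one_of_mem_closedBall (by
      have h1 : ‖ξ‖ < R := by simpa using hξ
      have h2 : ‖ξ‖ ≤ R + 1 := by linarith
      simpa [b] using h2)
    simp only [hF, this, one_mul]
  set J := ∫ ξ, F ξ with hJdef
  have hJ0 : 0 < J := lt_trans (by positivity) hJ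
  refine ⟨χ, J, hJ0, ?_, fun i => ?_⟩
  · rw [hJdef, ← integral_neg, ← integral_complex_ofReal]
    refine integral_congr_ae (Eventually.of_forall fun ξ => ?_)
    simp only [sum_apply]
    rw [sum_mulCoord_mulCoord, hχ_apply, hF]
    push_cast
    ring
  · have h1 : ‖(mulCoord i χ).toLp 2 volume‖ ^ 2 ≤ max 1 lam * J := by
      have e1 : ∫ ξ, ‖(mulCoord i χ).toLp 2 volume ξ‖ ^ 2 = ∫ ξ, ‖mulCoord i χ ξ‖ ^ 2 := by
        refine integral_congr_ae ?_
        filter_upwards [(mulCoord i χ).coeFn_toLp 2 volume] with ξ hξ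
        rw [hξ]
      rw [Lp_two_norm_sq_eq, e1, hJdef, ← integral_const_mul]
      have i1 : Integrable fun ξ => ‖mulCoord i χ ξ‖ ^ 2 :=
        (memLp_two_iff_integrable_sq_norm (mulCoord i χ).continuous.aestronglyMeasurable).1
          ((mulCoord i χ).memLp 2 volume)
      refine integral_mono i1 (hFint.const_mul _) fun ξ => ?_
      have s1 := symbol_pos hlam ξ
      have s2 := symbol_pos one_pos ξ
      have hb0 : 0 ≤ b ξ := b.nonneg
      have hb1 : b ξ ≤ 1 := b.le_one
      have e2 : ‖mulCoord i χ ξ‖ = 2 * Real.pi * (|ξ i| * (b ξ * symbol N 1 ξ)) := by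
        rw [mulCoord_apply, hχ_apply]
        simp [abs_of_pos hpi, abs_of_nonneg hb0, abs_of_pos s2]
      have h3 : |ξ i| ≤ ‖ξ‖ := by simpa using PiLp.norm_apply_le ξ i
      have h4 : symbol N 1 ξ ≤ max 1 lam * symbol N lam ξ := by
        simp only [symbol]
        rw [inv_le_iff_one_le_mul₀ (by positivity), mul_right_comm,
          ← div_eq_mul_inv, one_le_div (by positivity)]
        have := le_max_left 1 lam
        have := le_max_right 1 lam
        have h5 : 0 ≤ 4 * Real.pi ^ 2 * ‖ξ‖ ^ 2 := by positivity
        nlinarith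
      calc ‖mulCoord i χ ξ‖ ^ 2 = 4 * Real.pi ^ 2 * |ξ i| ^ 2 * (b ξ * b ξ) *
            (symbol N 1 ξ * symbol N 1 ξ) := by rw [e2]; ring
        _ ≤ 4 * Real.pi ^ 2 * ‖ξ‖ ^ 2 * (b ξ * 1) *
            (max 1 lam * symbol N lam ξ * symbol N 1 ξ) := by gcongr
        _ = max 1 lam * F ξ := by rw [hF]; ring
    have h2 : max 1 lam * J ≤ (ε * J) ^ 2 := by
      rw [div_lt_iff₀ (by positivity)] at hJ
      nlinarith
    exact (sq_le_sq₀ (norm_nonneg _) (by positivity)).1 (h1.trans h2)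

/-- The charge is controlled by an arbitrarily small multiple of the gradient of the regular part
and by the norm of the function `f + c G` in `L^r`. -/
lemma charge_estimate (hN2 : 2 ≤ N) (hN : N < 4) {lam ε : ℝ} (hlam : 0 < lam) (hε : 0 < ε)
    {q r r' : ℝ≥0∞} [Fact (1 ≤ q)] [Fact (1 ≤ r)] [Fact (1 ≤ r')] [ENNReal.HolderConjugate r' r] :
    ∃ C, 0 ≤ C ∧ ∀ (g : regularSpace N q) (c : ℂ) (U : Lp ℂ r (volume : Measure (Space N))),
      (U =ᵐ[volume] fun x => g.1.1 x + c * (green N lam x : ℂ)) →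
      ‖c‖ ≤ ε * ‖g.1.2‖ + C * ‖U‖ := by
  have hN0 : (0 : ℝ) < N := by exact_mod_cast (by omega : 0 < N)
  obtain ⟨χ, J, hJ, hχ, hgrad⟩ := exists_charge_test hN2 hlam (div_pos hε hN0)
  set ψ : 𝓢(Space N, ℂ) := ∑ i, mulCoord i (mulCoord i χ) with hψ
  have hFψ : 𝓕 ψ = ∑ i, 𝓕 (mulCoord i (mulCoord i χ)) := by
    rw [hψ]
    exact map_sum (fourierCLM ℂ 𝓢(Space N, ℂ)) _ _
  refine ⟨‖(𝓕 ψ).toLp r' volume‖ / J, by positivity, fun g c U hU => ?_⟩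
  have := ENNReal.HolderConjugate.inv_one_sub_inv' (Fact.out : 1 ≤ q)
  have i1 : Integrable fun x => 𝓕 ψ x * g.1.1 x :=
    ((𝓕 ψ).memLp (1 - q⁻¹)⁻¹ volume).integrable_mul (Lp.memLp g.1.1)
  have i2 : Integrable fun x => 𝓕 ψ x * (green N lam x : ℂ) :=
    ((𝓕 ψ).memLp 2 volume).integrable_mul (memLp_two_green hN hlam)
  have key : ∫ x, 𝓕 ψ x * U x =
      (-∑ i, ∫ x, 𝓕 (mulCoord i χ) x * g.1.2 i x) + c * ((-J : ℝ) : ℂ) := by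
    rw [← hχ, ← integral_fourier_mul_green hN hlam, ← integral_laplacian_test g χ, ← hFψ,
      ← integral_const_mul, ← integral_add i1 (i2.const_mul c)]
    refine integral_congr_ae ?_
    filter_upwards [hU] with x hx
    rw [hx]
    ring
  have h1 : ‖∫ x, 𝓕 ψ x * U x‖ ≤ ‖(𝓕 ψ).toLp r' volume‖ * ‖U‖ :=
    norm_integral_schwartz_mul_le _ _
  have h2 : ∀ i, ‖∫ x, 𝓕 (mulCoord i χ) x * g.1.2 i x‖ ≤ ε / N * J * ‖g.1.2‖ := by
    intro i
    refine (norm_integral_schwartz_mul_le (r := 2) _ _).trans ?_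
    have e : ‖(𝓕 (mulCoord i χ)).toLp 2 volume‖ = ‖(mulCoord i χ).toLp 2 volume‖ := by
      rw [← SchwartzMap.toLp_fourier_eq, Lp.norm_fourier_eq]
    rw [e]
    have := hgrad i
    have := PiLp.norm_apply_le g.1.2 i
    gcongr
  have h3 : ‖∑ i, ∫ x, 𝓕 (mulCoord i χ) x * g.1.2 i x‖ ≤ ε * J * ‖g.1.2‖ := by
    refine (norm_sum_le_of_le _ fun i _ => h2 i).trans (le_of_eq ?_)
    rw [Finset.sum_const, Finset.card_univ, Fintype.card_fin, nsmul_eq_mul]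
    field_simp
  have h4 : ‖c‖ * J ≤ ε * J * ‖g.1.2‖ + ‖(𝓕 ψ).toLp r' volume‖ * ‖U‖ := by
    have e : c * (J : ℂ) = (-∑ i, ∫ x, 𝓕 (mulCoord i χ) x * g.1.2 i x) - ∫ x, 𝓕 ψ x * U x := by
      rw [key]
      push_cast
      ring
    have e2 : ‖c‖ * J = ‖c * (J : ℂ)‖ := by
      rw [norm_mul, Complex.norm_real, Real.norm_of_nonneg hJ.le]
    rw [e2, e]
    refine (norm_sub_le _ _).trans ?_
    rw [norm_neg]
    exact add_le_add h3 h1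
  have h5 : ‖c‖ ≤ (ε * J * ‖g.1.2‖ + ‖(𝓕 ψ).toLp r' volume‖ * ‖U‖) / J := by
    rwa [le_div_iff₀ hJ]
  refine h5.trans (le_of_eq ?_)
  field_simp

end PointInteraction

/-! ### The space of regular parts -/

namespace PointInteraction
open FourierTransform

variable {N : ℕ}

instance completeSpace_regularSpace (q : ℝ≥0∞) [Fact (1 ≤ q)] :
    CompleteSpace (regularSpace N q) := by
  have : IsClosed (regularSpace N q : Set (Lp ℂ q (volume : Measure (Space N)) ×
      PiLp 2 (fun _ : Fin N => Lp ℂ 2 (volume : Measure (Space N))))) := by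
    have e : (regularSpace N q : Set (Lp ℂ q (volume : Measure (Space N)) ×
        PiLp 2 (fun _ : Fin N => Lp ℂ 2 (volume : Measure (Space N))))) =
        ⋂ i : Fin N, {g | LineDeriv.lineDerivOpCLM ℂ 𝓢'(Space N, ℂ) (basisVec i)
          (Lp.toTemperedDistributionCLM ℂ volume q g.1) =
            Lp.toTemperedDistributionCLM ℂ volume 2 (g.2 i)} := by
      ext g
      simp only [mem_iInter]
      rfl
    rw [e]
    refine isClosed_iInter fun i => isClosed_eq ?_ ?_
    · exact (LineDeriv.lineDerivOpCLM ℂ 𝓢'(Space N, ℂ) (basisVec i)).continuous.comp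
        ((Lp.toTemperedDistributionCLM ℂ volume q).continuous.comp continuous_fst)
    · exact (Lp.toTemperedDistributionCLM ℂ volume 2).continuous.comp
        ((PiLp.continuous_apply 2 _ i).comp continuous_snd)
  exact this.completeSpace_coe

/-- A function in `L^q` whose gradient is in `L²` and which lies in `L^r` depends continuously on
its norm in `L^q ∩ Ḣ¹`, by the closed graph theorem. -/
lemma continuous_regularSpace_inclusion {q r : ℝ≥0∞} [Fact (1 ≤ q)] [Fact (1 ≤ r)]
    (J : regularSpace N q →ₗ[ℂ] Lp ℂ r (volume : Measure (Space N)))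
    (hJ : ∀ g, J g =ᵐ[volume] g.1.1) : Continuous J := by
  refine J.continuous_of_seq_closed_graph fun u g y hu hy => ?_
  have hinj : Function.Injective (Lp.toTemperedDistributionCLM ℂ (volume : Measure (Space N)) r) :=
    LinearMap.ker_eq_bot.1 Lp.ker_toTemperedDistributionCLM_eq_bot
  refine hinj ?_
  have hsame : ∀ g, Lp.toTemperedDistributionCLM ℂ volume r (J g) =
      Lp.toTemperedDistributionCLM ℂ volume q g.1.1 := by
    intro g
    ext φ
    simp only [Lp.toTemperedDistributionCLM_apply, Lp.toTemperedDistribution_apply]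
    refine integral_congr_ae ?_
    filter_upwards [hJ g] with x hx
    rw [hx]
  have h1 := ((Lp.toTemperedDistributionCLM ℂ volume r).continuous.tendsto y).comp hy
  have h2 : Tendsto (fun n => Lp.toTemperedDistributionCLM ℂ volume q (u n).1.1) atTop
      (𝓝 (Lp.toTemperedDistributionCLM ℂ volume q g.1.1)) :=
    ((Lp.toTemperedDistributionCLM ℂ volume q).continuous.tendsto _).comp
      ((continuous_fst.comp continuous_subtype_val).tendsto g |>.comp hu)
  rw [hsame]
  refine tendsto_nhds_unique h1 (h2.congr fun n => ?_)
  exact (hsame (u n)).symm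

/-- The embedding of `L^q ∩ Ḣ¹` into `L^r` as a linear map. -/
noncomputable def regularInclusionLinear {q r : ℝ≥0∞} [Fact (1 ≤ q)] [Fact (1 ≤ r)]
    (h : ∀ g : regularSpace N q, MemLp g.1.1 r) :
    regularSpace N q →ₗ[ℂ] Lp ℂ r (volume : Measure (Space N)) where
  toFun g := (h g).toLp _
  map_add' f g := by
    refine Lp.ext ?_
    have e1 := (h (f + g)).coeFn_toLp
    have e2 := Lp.coeFn_add f.1.1 g.1.1
    have e3 := Lp.coeFn_add ((h f).toLp _) ((h g).toLp _)
    filter_upwards [e1, e2, e3, (h f).coeFn_toLp, (h g).coeFn_toLp] with x h1 h2 h3 h4 h5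
    rw [h1, h3, Pi.add_apply, h4, h5]
    exact h2
  map_smul' c g := by
    refine Lp.ext ?_
    have e1 := (h (c • g)).coeFn_toLp
    have e2 := Lp.coeFn_smul c g.1.1
    have e3 := Lp.coeFn_smul c ((h g).toLp _)
    filter_upwards [e1, e2, e3, (h g).coeFn_toLp] with x h1 h2 h3 h4
    rw [h1, RingHom.id_apply, h3, Pi.smul_apply, h4]
    exact h2

/-- The embedding of `L^q ∩ Ḣ¹` into `L^r`, provided that its elements are in `L^r`. -/
noncomputable def regularInclusion {q r : ℝ≥0∞} [Fact (1 ≤ q)] [Fact (1 ≤ r)]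
    (h : ∀ g : regularSpace N q, MemLp g.1.1 r) :
    regularSpace N q →L[ℂ] Lp ℂ r (volume : Measure (Space N)) :=
  ⟨regularInclusionLinear h,
    continuous_regularSpace_inclusion _ fun g => (h g).coeFn_toLp⟩

lemma coeFn_regularInclusion {q r : ℝ≥0∞} [Fact (1 ≤ q)] [Fact (1 ≤ r)]
    (h : ∀ g : regularSpace N q, MemLp g.1.1 r) (g : regularSpace N q) :
    regularInclusion h g =ᵐ[volume] g.1.1 := (h g).coeFn_toLp

/-- The Fourier transform of the weak gradient. -/
lemma fourier_weakDeriv_ae_eq (g : regularSpace N 2) (i : Fin N) :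
    (𝓕 (g.1.2 i) : Lp ℂ 2 (volume : Measure (Space N))) =ᵐ[volume]
      fun ξ => (2 * Real.pi * Complex.I) *
        (ξ i * (𝓕 g.1.1 : Lp ℂ 2 (volume : Measure (Space N))) ξ) := by
  have hloc : LocallyIntegrable (𝓕 g.1.1 : Lp ℂ 2 (volume : Measure (Space N))) :=
    (Lp.memLp _).locallyIntegrable one_le_two
  refine ae_eq_of_forall_schwartz ((Lp.memLp _).locallyIntegrable one_le_two) ?_ fun φ => ?_
  · have hc : Continuous fun ξ : Space N => (2 * Real.pi * Complex.I) * (ξ i : ℂ) := by fun_prop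
    have := (hloc.locallyIntegrableOn univ).continuousOn_mul hc.continuousOn
      isOpen_univ.isLocallyClosed
    rw [locallyIntegrableOn_univ] at this
    simpa only [mul_assoc] using this
  · rw [integral_schwartz_smul_Lp_fourier]
    simp only [smul_eq_mul]
    rw [integral_schwartz_weakDeriv, lineDeriv_fourier_schwartz]
    have h := integral_schwartz_smul_Lp_fourier g.1.1 (mulCoord i φ)
    simp only [smul_eq_mul] at h
    rw [← h, ← integral_neg]
    refine integral_congr_ae (Eventually.of_forall fun ξ => ?_)
    simp only [mulCoord_apply]
    ring

/-- The Sobolev embedding `H¹ ⊂ L^q`, `2 ≤ q`, `N (1/2 - 1/q) < 1`. -/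
lemma memLp_of_regularSpace_two {q : ℝ} (hq : 2 ≤ q) (hNq : (N : ℝ) / 2 * (1 - 2 / q) < 1)
    (g : regularSpace N 2) : MemLp g.1.1 (ENNReal.ofReal q) := by
  have h := memLp_fourierInv_of_dyadic_decay (N := N) (C := ∑ i, ‖g.1.2 i‖) hq (by positivity) hNq
    (𝓕 g.1.1) fun k => ?_
  · rwa [fourierInv_fourier_eq] at h
  set s := Metric.ball (0 : Space N) (2 ^ (k + 1)) \ Metric.ball 0 (2 ^ k) with hs
  have hsm : MeasurableSet s := measurableSet_ball.diff measurableSet_ball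
  have hder : ∀ᵐ ξ, ∀ i, (𝓕 (g.1.2 i) : Lp ℂ 2 (volume : Measure (Space N))) ξ =
      (2 * Real.pi * Complex.I) * (ξ i * (𝓕 g.1.1 : Lp ℂ 2 (volume : Measure (Space N))) ξ) :=
    ae_all_iff.2 fun i => fourier_weakDeriv_ae_eq g i
  have hpt : ∀ᵐ ξ, ‖cutoff s hsm (𝓕 g.1.1) ξ‖ ≤ (2 ^ (-1 : ℝ)) ^ k *
      ‖(∑ i, fun ξ => ‖(𝓕 (g.1.2 i) : Lp ℂ 2 (volume : Measure (Space N))) ξ‖) ξ‖ := by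
    filter_upwards [hder, coeFn_cutoff hsm (𝓕 g.1.1)] with ξ h1 h2
    rw [h2]
    by_cases hξ : ξ ∈ s
    · rw [indicator_of_mem hξ, Finset.sum_apply, Real.norm_of_nonneg (by positivity)]
      have h3 : (2 : ℝ) ^ k ≤ ‖ξ‖ := by simpa using hξ.2
      have h4 : ‖ξ‖ ≤ ∑ i, |ξ i| := by
        have hsum : ξ = ∑ i, ξ i • basisVec i := by
          ext j
          simp [basisVec, Pi.single_apply]
        calc ‖ξ‖ = ‖∑ i, ξ i • basisVec i‖ := by rw [← hsum]
          _ ≤ ∑ i, ‖ξ i • basisVec i‖ := norm_sum_le _ _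
          _ = _ := by simp [norm_smul, basisVec]
      have e : (2 ^ (-1 : ℝ) : ℝ) ^ k = (2 ^ k)⁻¹ := by
        rw [Real.rpow_neg_one, inv_pow]
      rw [e, ← div_eq_inv_mul, le_div_iff₀ (by positivity)]
      set W := ‖(𝓕 g.1.1 : Lp ℂ 2 (volume : Measure (Space N))) ξ‖ with hW
      have hW0 : 0 ≤ W := norm_nonneg _
      calc W * 2 ^ k ≤ W * ∑ i, |ξ i| := by gcongr; exact h3.trans h4
        _ = ∑ i, |ξ i| * W := by rw [Finset.mul_sum]; exact Finset.sum_congr rfl fun i _ => mul_comm _ _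
        _ ≤ _ := by
          refine Finset.sum_le_sum fun i _ => ?_
          rw [h1 i, norm_mul, norm_mul, norm_mul, norm_mul, Complex.norm_I, Complex.norm_real,
            Complex.norm_real, ← hW, Real.norm_eq_abs, Real.norm_eq_abs, abs_of_pos Real.pi_pos]
          have h5 : 1 ≤ ‖(2 : ℂ)‖ * Real.pi * 1 := by
            rw [Complex.norm_ofNat]
            linarith [Real.pi_gt_three]
          exact le_mul_of_one_le_left (by positivity) h5
    · rw [indicator_of_notMem hξ, norm_zero]
      positivity
  have h6 := eLpNorm_le_mul_eLpNorm_of_ae_le_mul hpt 2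
  have h7 : eLpNorm (∑ i, fun ξ => ‖(𝓕 (g.1.2 i) : Lp ℂ 2 (volume : Measure (Space N))) ξ‖) 2 volume
      ≤ ENNReal.ofReal (∑ i, ‖g.1.2 i‖) := by
    refine (eLpNorm_sum_le (fun i _ => (Lp.aestronglyMeasurable _).norm) one_le_two).trans ?_
    rw [ENNReal.ofReal_sum_of_nonneg fun i _ => norm_nonneg _]
    refine Finset.sum_le_sum fun i _ => ?_
    rw [eLpNorm_norm, ← Lp.norm_fourier_eq (g.1.2 i), Lp.norm_def,
      ENNReal.ofReal_toReal (Lp.eLpNorm_ne_top _)]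
  refine ENNReal.toReal_le_of_le_ofReal (by positivity) (h6.trans ?_)
  rw [mul_comm, ENNReal.ofReal_mul (by positivity)]
  gcongr

/-! ### Differences of Green functions -/

/-- The Fourier transform of `∂_i (G_m - G_l)`. -/
noncomputable def greenDiffSymbol (m l : ℝ) (i : Fin N) (ξ : Space N) : ℂ :=
  (2 * Real.pi * Complex.I) * (ξ i * ((symbol N m ξ : ℂ) - symbol N l ξ))

lemma memLp_greenDiffSymbol (hN : N < 4) {m l : ℝ} (hm : 0 < m) (hl : 0 < l) (i : Fin N) :
    MemLp (greenDiffSymbol (N := N) m l i) 2 := by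
  have hc : Continuous (greenDiffSymbol (N := N) m l i) := by
    have h1 := Complex.continuous_ofReal.comp (continuous_symbol (N := N) hm)
    have h2 := Complex.continuous_ofReal.comp (continuous_symbol (N := N) hl)
    exact continuous_const.mul ((by fun_prop : Continuous fun ξ : Space N => (ξ i : ℂ)).mul
      (h1.sub h2))
  refine (memLp_symbol hN hl).of_le_mul (c := 2 * Real.pi * (|l - m| * (min m 1)⁻¹))
    hc.aestronglyMeasurable (Eventually.of_forall fun ξ => ?_)
  have s1 := symbol_pos hm ξ
  have s2 := symbol_pos hl ξ
  have e : (symbol N m ξ : ℂ) - symbol N l ξ = (((l - m) * (symbol N m ξ * symbol N l ξ) : ℝ) : ℂ) := by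
    rw [← Complex.ofReal_sub]
    congr 1
    have h1 := (symbol_denom_pos hm ξ).ne'
    have h2 := (symbol_denom_pos hl ξ).ne'
    simp only [symbol]
    field_simp
    ring
  rw [greenDiffSymbol, e, norm_mul, norm_mul, norm_mul, norm_mul, Complex.norm_I, Complex.norm_real,
    Complex.norm_real, Complex.norm_real, Complex.norm_real, Complex.norm_ofNat, Real.norm_eq_abs,
    Real.norm_eq_abs, Real.norm_eq_abs, Real.norm_eq_abs, abs_of_pos Real.pi_pos, abs_mul, abs_mul,
    abs_of_pos s1, abs_of_pos s2]
  have h3 : |ξ i| ≤ ‖ξ‖ := by simpa using PiLp.norm_apply_le ξ i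
  have h4 : ‖ξ‖ ≤ 1 + ‖ξ‖ ^ 2 := by nlinarith [sq_nonneg (‖ξ‖ - 1), sq_nonneg ‖ξ‖]
  have h5 : |ξ i| * symbol N m ξ ≤ (min m 1)⁻¹ := by
    calc |ξ i| * symbol N m ξ ≤ (1 + ‖ξ‖ ^ 2) * ((min m 1)⁻¹ * (1 + ‖ξ‖ ^ 2)⁻¹) := by
          gcongr
          · exact h3.trans h4
          · exact symbol_le hm ξ
      _ = _ := by field_simp
  calc 2 * Real.pi * 1 * (|ξ i| * (|l - m| * (symbol N m ξ * symbol N l ξ))) =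
        2 * Real.pi * (|l - m| * (|ξ i| * symbol N m ξ)) * symbol N l ξ := by ring
    _ ≤ _ := by
      have := Real.pi_pos
      gcongr

/-- The difference of two Green functions is a regular part: its singularities cancel. -/
lemma exists_regular_green_sub (hN : N < 4) {m l : ℝ} (hm : 0 < m) (hl : 0 < l) {q : ℝ≥0∞}
    [Fact (1 ≤ q)] (hmq : MemLp (fun x : Space N => (green N m x : ℂ)) q)
    (hlq : MemLp (fun x : Space N => (green N l x : ℂ)) q) :
    ∃ g : regularSpace N q,
      (g.1.1 =ᵐ[volume] fun x => (green N m x : ℂ) - green N l x) ∧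
      ‖g.1.2‖ ^ 2 = (l + m) * (∫ ξ : Space N, symbol N l ξ * symbol N m ξ)
        - l * (∫ ξ : Space N, symbol N l ξ * symbol N l ξ)
        - m * ∫ ξ : Space N, symbol N m ξ * symbol N m ξ := by
  set D : PiLp 2 (fun _ : Fin N => Lp ℂ 2 (volume : Measure (Space N))) :=
    WithLp.toLp 2 fun i => 𝓕⁻ ((memLp_greenDiffSymbol hN hm hl i).toLp _) with hD
  have hDi : ∀ i, D i = 𝓕⁻ ((memLp_greenDiffSymbol hN hm hl i).toLp _) := fun i => rfl
  have hf := (hmq.sub hlq).coeFn_toLp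
  refine ⟨⟨((hmq.sub hlq).toLp _, D), fun i => ?_⟩, hf, ?_⟩
  · ext φ
    rw [TemperedDistribution.lineDerivOp_apply_apply, Lp.toTemperedDistribution_apply,
      Lp.toTemperedDistribution_apply]
    simp only
    rw [hDi, integral_schwartz_smul_Lp_fourierInv]
    have hw := integral_schwartz_smul_Lp_fourierInv (symbolLp hN hm - symbolLp hN hl)
      (-∂_{basisVec i} φ)
    have e1 : 𝓕⁻ (-∂_{basisVec i} φ) = -mulCoord i (𝓕⁻ φ) := by
      have : 𝓕⁻ (∂_{basisVec i} φ) = mulCoord i (𝓕⁻ φ) := SchwartzMap.fourierInv_lineDerivOp_eq φ _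
      rw [← this]
      exact map_neg (fourierInvCLM ℂ 𝓢(Space N, ℂ)) _
    have e2 : 𝓕⁻ (symbolLp hN hm - symbolLp hN hl) =
        𝓕⁻ (symbolLp hN hm) - 𝓕⁻ (symbolLp hN hl) :=
      map_sub (fourierInvCLM ℂ (Lp ℂ 2 (volume : Measure (Space N)))) _ _
    rw [e1, e2] at hw
    refine Eq.trans (integral_congr_ae ?_) (hw.trans (integral_congr_ae ?_))
    · filter_upwards [hf, Lp.coeFn_sub (𝓕⁻ (symbolLp hN hm)) (𝓕⁻ (symbolLp hN hl)),
        fourierInv_symbolLp_ae_eq hN hm, fourierInv_symbolLp_ae_eq hN hl] with x h1 h2 h3 h4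
      rw [h1, h2, Pi.sub_apply, Pi.sub_apply, h3, h4]
    · filter_upwards [Lp.coeFn_sub (symbolLp hN hm) (symbolLp hN hl),
        (memLp_symbol hN hm).coeFn_toLp, (memLp_symbol hN hl).coeFn_toLp,
        (memLp_greenDiffSymbol hN hm hl i).coeFn_toLp] with ξ h1 h2 h3 h4
      rw [h1, h4, Pi.sub_apply, symbolLp, symbolLp, h2, h3, neg_apply, mulCoord_apply,
        greenDiffSymbol]
      simp only [smul_eq_mul]
      ring
  · have i1 := integrable_symbol_mul_symbol (N := N) hN hl hm
    have i2 := integrable_symbol_mul_symbol (N := N) hN hl hl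
    have i3 := integrable_symbol_mul_symbol (N := N) hN hm hm
    rw [PiLp.norm_sq_eq_of_L2]
    have e1 : ∀ i, ‖D i‖ ^ 2 = ∫ ξ : Space N,
        4 * Real.pi ^ 2 * (ξ i) ^ 2 * (symbol N m ξ - symbol N l ξ) ^ 2 := by
      intro i
      rw [hDi, ← Lp.norm_fourier_eq, fourier_fourierInv_eq, Lp_two_norm_sq_eq]
      refine integral_congr_ae ?_
      filter_upwards [(memLp_greenDiffSymbol hN hm hl i).coeFn_toLp] with ξ h4
      rw [h4, greenDiffSymbol, ← Complex.ofReal_sub]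
      simp only [norm_mul, Complex.norm_I, Complex.norm_real, Complex.norm_ofNat,
        Real.norm_eq_abs]
      rw [abs_of_pos Real.pi_pos, ← sq_abs (ξ i), ← sq_abs (symbol N m ξ - symbol N l ξ)]
      ring
    have e2 : ∀ i, Integrable fun ξ : Space N =>
        4 * Real.pi ^ 2 * (ξ i) ^ 2 * (symbol N m ξ - symbol N l ξ) ^ 2 := by
      intro i
      have := (memLp_two_iff_integrable_sq_norm
        (memLp_greenDiffSymbol (N := N) hN hm hl i).1).1 (memLp_greenDiffSymbol hN hm hl i)
      refine this.congr (Eventually.of_forall fun ξ => ?_)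
      simp only [greenDiffSymbol, ← Complex.ofReal_sub, norm_mul, Complex.norm_I,
        Complex.norm_real, Complex.norm_ofNat, Real.norm_eq_abs]
      rw [abs_of_pos Real.pi_pos, ← sq_abs (ξ i), ← sq_abs (symbol N m ξ - symbol N l ξ)]
      ring
    simp only [e1]
    have i12 : Integrable fun ξ : Space N => (l + m) * (symbol N l ξ * symbol N m ξ) -
        l * (symbol N l ξ * symbol N l ξ) := (i1.const_mul _).sub (i2.const_mul _)
    rw [← integral_finsetSum _ fun i _ => e2 i, ← integral_const_mul, ← integral_const_mul,
      ← integral_const_mul, ← integral_sub (i1.const_mul _) (i2.const_mul _),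
      ← integral_sub i12 (i3.const_mul _)]
    refine integral_congr_ae (Eventually.of_forall fun ξ => ?_)
    simp only
    rw [← Finset.sum_mul, ← Finset.mul_sum]
    have e3 : ∑ i, ξ i ^ 2 = ‖ξ‖ ^ 2 := by
      rw [EuclideanSpace.norm_sq_eq]
      simp
    have h1 := (symbol_denom_pos hm ξ).ne'
    have h2 := (symbol_denom_pos hl ξ).ne'
    rw [e3]
    simp only [symbol]
    field_simp
    ring

end PointInteraction

/-! ### Minimization of an abstract action -/

namespace PointInteraction

/-- A quadratic term is absorbed by a small multiple of a higher power. -/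
lemma exists_mul_sq_le_mul_rpow_add {q : ℝ} (hq : 2 < q) (C : ℝ) {δ : ℝ} (hδ : 0 < δ) :
    ∃ M : ℝ, 0 ≤ M ∧ ∀ t : ℝ, 0 ≤ t → C * t ^ 2 ≤ δ * t ^ q + M := by
  set T := (|C| / δ) ^ (1 / (q - 2)) with hT
  refine ⟨|C| * T ^ 2, by positivity, fun t ht => ?_⟩
  have hC : C * t ^ 2 ≤ |C| * t ^ 2 := by gcongr; exact le_abs_self C
  rcases le_total t T with h | h
  · have : |C| * t ^ 2 ≤ |C| * T ^ 2 := by gcongr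
    have : 0 ≤ δ * t ^ q := by positivity
    linarith
  · have h1 : |C| / δ ≤ t ^ (q - 2) := by
      have := Real.rpow_le_rpow (by positivity) h (by linarith : (0 : ℝ) ≤ q - 2)
      rwa [hT, ← Real.rpow_mul (by positivity), one_div, inv_mul_cancel₀ (by linarith),
        Real.rpow_one] at this
    rw [div_le_iff₀ hδ] at h1
    have h2 : t ^ q = t ^ (q - 2) * t ^ 2 := by
      rw [← Real.rpow_natCast t 2, ← Real.rpow_add' ht (by push_cast; linarith)]
      congr 1
      push_cast
      ring
    have h3 : |C| * t ^ 2 ≤ t ^ (q - 2) * δ * t ^ 2 := by gcongr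
    have : 0 ≤ |C| * T ^ 2 := by positivity
    rw [h2]
    linarith

variable {X H K Ω : Type*} [NormedAddCommGroup X] [NormedSpace ℂ X]
  [NormedAddCommGroup H] [InnerProductSpace ℂ H] [NormedAddCommGroup K] [InnerProductSpace ℂ K]
  [MeasurableSpace Ω] {μ : Measure Ω} {q : ℝ} [Fact (1 ≤ ENNReal.ofReal q)]

variable (X H K μ q) in
/-- The data of an action functional on a space `X` of functions with a charge: the linear maps
taking an element to the gradient of its regular part, to its charge, to the function itself in
`L^q`, and to the function in a further Hilbert space, a functional `pair` on `L^q`, and the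
coefficients of the action `FormData.action`. -/
structure FormData where
  /-- the gradient of the regular part -/
  grad : X →L[ℂ] H
  /-- the charge -/
  charge : X →L[ℂ] ℂ
  /-- the function in `L^q` -/
  val : X →L[ℂ] Lp ℂ (ENNReal.ofReal q) μ
  /-- the function in the Hilbert space of the mass term -/
  mass : X →L[ℂ] K
  /-- the functional that is coupled to the charge -/
  pair : Lp ℂ (ENNReal.ofReal q) μ →L[ℂ] ℂ
  /-- the coefficient of the squared charge -/
  a : ℝ
  /-- the coefficient of the coupling -/
  lam : ℝ
  /-- the coefficient of the mass term -/
  ω : ℝ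
  ω_nonneg : 0 ≤ ω
  /-- the charge is bounded by the gradient and the function, with a small constant in front of the
  gradient -/
  charge_le : ∀ ε : ℝ, 0 < ε → ∃ C : ℝ, 0 ≤ C ∧ ∀ v, ‖charge v‖ ≤ ε * ‖grad v‖ + C * ‖val v‖
  /-- the quantities in the action control the norm -/
  norm_le : ∃ C : ℝ, ∀ v, ‖v‖ ≤ C * (‖grad v‖ + ‖charge v‖ + ‖val v‖ + ω * ‖mass v‖)

namespace FormData

variable (F : FormData X H K μ q)

/-- The quadratic part of the action. -/
noncomputable def quad (v : X) : ℝ :=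
  ‖F.grad v‖ ^ 2 + F.a * ‖F.charge v‖ ^ 2
    - 2 * F.lam * (starRingEnd ℂ (F.charge v) * F.pair (F.val v)).re + F.ω * ‖F.mass v‖ ^ 2

/-- The action: a quadratic form plus a multiple of the `q`-th power of the `L^q` norm. -/
noncomputable def action (v : X) : ℝ := 1 / 2 * F.quad v + 1 / q * ‖F.val v‖ ^ q

lemma continuous_action (hq : 2 < q) : Continuous F.action := by
  unfold action quad
  have : Continuous fun v => ‖F.val v‖ ^ q :=
    (F.val.continuous.norm).rpow_const fun _ => Or.inr (by linarith)
  have h2 : Continuous fun v => (starRingEnd ℂ (F.charge v) * F.pair (F.val v)).re :=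
    Complex.continuous_re.comp ((Complex.continuous_conj.comp F.charge.continuous).mul
      (F.pair.continuous.comp F.val.continuous))
  fun_prop

lemma quad_add_add_quad_sub (x y : X) :
    F.quad (x + y) + F.quad (x - y) = 2 * (F.quad x + F.quad y) := by
  have h1 := parallelogram_law_with_norm ℂ (F.grad x) (F.grad y)
  have h2 := parallelogram_law_with_norm ℂ (F.mass x) (F.mass y)
  have h3 := parallelogram_law_with_norm ℂ (F.charge x) (F.charge y)
  simp only [quad, map_add, map_sub]
  simp only [add_mul, mul_add, sub_mul, mul_sub, Complex.add_re, Complex.sub_re]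
  linear_combination h1 + F.ω * h2 + F.a * h3

lemma quad_smul (t : ℝ) (x : X) : F.quad ((t : ℂ) • x) = t ^ 2 * F.quad x := by
  simp only [quad, map_smul, norm_smul, mul_pow, smul_eq_mul, Complex.norm_real, Real.norm_eq_abs,
    sq_abs, norm_mul, map_mul, Complex.conj_ofReal]
  have : ((t : ℂ) * (starRingEnd ℂ) (F.charge x) * ((t : ℂ) * F.pair (F.val x))).re =
      t ^ 2 * ((starRingEnd ℂ) (F.charge x) * F.pair (F.val x)).re := by
    rw [← Complex.re_ofReal_mul]
    congr 1
    push_cast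
    ring
  rw [this]
  ring

lemma abs_coupling_le (v : X) :
    |(starRingEnd ℂ (F.charge v) * F.pair (F.val v)).re| ≤
      ‖F.charge v‖ * (‖F.pair‖ * ‖F.val v‖) := by
  refine (Complex.abs_re_le_norm _).trans ?_
  rw [norm_mul, RCLike.norm_conj]
  gcongr
  exact F.pair.le_opNorm _

lemma quad_ge (v : X) : ‖F.grad v‖ ^ 2 + F.ω * ‖F.mass v‖ ^ 2 -
    (|F.a| * ‖F.charge v‖ ^ 2 + 2 * |F.lam| * (‖F.charge v‖ * (‖F.pair‖ * ‖F.val v‖))) ≤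
    F.quad v := by
  have h1 : -(|F.a| * ‖F.charge v‖ ^ 2) ≤ F.a * ‖F.charge v‖ ^ 2 := by
    rw [← neg_mul]
    gcongr
    exact neg_abs_le _
  have h2 : F.lam * (starRingEnd ℂ (F.charge v) * F.pair (F.val v)).re ≤
      |F.lam| * (‖F.charge v‖ * (‖F.pair‖ * ‖F.val v‖)) := by
    refine (le_abs_self _).trans ?_
    rw [abs_mul]
    gcongr
    exact F.abs_coupling_le v
  unfold quad
  linarith

lemma quad_le : ∃ C : ℝ, 0 ≤ C ∧ ∀ v, F.quad v ≤ C * ‖v‖ ^ 2 := by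
  refine ⟨‖F.grad‖ ^ 2 + |F.a| * ‖F.charge‖ ^ 2 +
    2 * |F.lam| * (‖F.charge‖ * (‖F.pair‖ * ‖F.val‖)) + F.ω * ‖F.mass‖ ^ 2, ?_, fun v => ?_⟩
  · have := F.ω_nonneg
    positivity
  have h1 : ‖F.grad v‖ ^ 2 ≤ (‖F.grad‖ * ‖v‖) ^ 2 := by gcongr; exact F.grad.le_opNorm v
  have h2 : F.a * ‖F.charge v‖ ^ 2 ≤ |F.a| * (‖F.charge‖ * ‖v‖) ^ 2 := by
    gcongr
    · exact le_abs_self _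
    · exact F.charge.le_opNorm v
  have h3 : F.ω * ‖F.mass v‖ ^ 2 ≤ F.ω * (‖F.mass‖ * ‖v‖) ^ 2 := by
    have := F.ω_nonneg
    gcongr
    exact F.mass.le_opNorm v
  have h4 : -(F.lam * (starRingEnd ℂ (F.charge v) * F.pair (F.val v)).re) ≤
      |F.lam| * ((‖F.charge‖ * ‖v‖) * (‖F.pair‖ * (‖F.val‖ * ‖v‖))) := by
    refine (neg_le_abs _).trans ?_
    rw [abs_mul]
    gcongr
    refine (F.abs_coupling_le v).trans ?_
    gcongr
    · exact F.charge.le_opNorm v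
    · exact F.val.le_opNorm v
  unfold quad
  linarith

/-- The midpoint inequality, which comes from the parallelogram law for the quadratic part and from
Clarkson's inequality in `L^q`. -/
lemma action_midpoint_add_le (hq : 2 < q) (x y : X) :
    F.action (((1 / 2 : ℝ) : ℂ) • (x + y)) + F.action (((1 / 2 : ℝ) : ℂ) • (x - y)) ≤
      (F.action x + F.action y) / 2 := by
  have h1 := clarkson_Lp hq.le (F.val x) (F.val y)
  have h2 := F.quad_add_add_quad_sub x y
  have e : ∀ z : Lp ℂ (ENNReal.ofReal q) μ, ((1 / 2 : ℝ) : ℂ) • z = (1 / 2 : ℝ) • z :=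
    fun z => Complex.coe_smul _ z
  have h3 := mul_le_mul_of_nonneg_left h1 (by positivity : (0 : ℝ) ≤ 1 / q)
  simp only [action, F.quad_smul]
  rw [map_smul, map_smul, map_add, map_sub, e, e]
  linarith

/-- The action controls the gradient and the `L^q` norm. The terms with the charge are quadratic; by
`charge_le` they are absorbed by the gradient up to a multiple of the squared `L^q` norm, which is
of lower order than its `q`-th power. -/
lemma action_coercive (hq : 2 < q) :
    ∃ M : ℝ, ∀ v, 1 / 4 * ‖F.grad v‖ ^ 2 + 1 / (2 * q) * ‖F.val v‖ ^ q - M ≤ F.action v := by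
  set B := |F.a| + |F.lam| * ‖F.pair‖ with hB
  -- small enough for `2 B ε² ≤ 1 / 2`
  have hB0 : 0 ≤ B := by positivity
  set ε := 1 / (2 * (B + 1)) with hε
  have hε0 : 0 < ε := by positivity
  obtain ⟨C, hC, hc⟩ := F.charge_le ε hε0
  obtain ⟨M, -, hM⟩ := exists_mul_sq_le_mul_rpow_add hq (B * C ^ 2 + |F.lam| * ‖F.pair‖ / 2)
    (by positivity : 0 < 1 / (2 * q))
  refine ⟨M, fun v => ?_⟩
  have hv := hM ‖F.val v‖ (norm_nonneg _)
  have h1 := F.quad_ge v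
  have h2 : ‖F.charge v‖ ^ 2 ≤ 2 * ε ^ 2 * ‖F.grad v‖ ^ 2 + 2 * C ^ 2 * ‖F.val v‖ ^ 2 := by
    have h := pow_le_pow_left₀ (norm_nonneg _) (hc v) 2
    nlinarith [sq_nonneg (ε * ‖F.grad v‖ - C * ‖F.val v‖)]
  have h3 : 2 * (‖F.charge v‖ * ‖F.val v‖) ≤ ‖F.charge v‖ ^ 2 + ‖F.val v‖ ^ 2 := by
    nlinarith [sq_nonneg (‖F.charge v‖ - ‖F.val v‖)]
  have h4 := mul_le_mul_of_nonneg_left h3 (by positivity : 0 ≤ |F.lam| * ‖F.pair‖)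
  have h5 := mul_le_mul_of_nonneg_left h2 hB0
  have h6 : B * (2 * ε ^ 2) ≤ 1 / 2 := by
    have : B * (2 * ε ^ 2) = B / (2 * (B + 1) ^ 2) := by
      rw [hε]
      field_simp
    rw [this, div_le_div_iff₀ (by positivity) two_pos]
    nlinarith
  have h7 := mul_le_mul_of_nonneg_right h6 (sq_nonneg ‖F.grad v‖)
  have h8 : 0 ≤ F.ω * ‖F.mass v‖ ^ 2 := mul_nonneg F.ω_nonneg (sq_nonneg _)
  have h9 : 1 / q * ‖F.val v‖ ^ q = 2 * (1 / (2 * q) * ‖F.val v‖ ^ q) := by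
    field_simp
  have e5 : B * ‖F.charge v‖ ^ 2 =
      |F.a| * ‖F.charge v‖ ^ 2 + |F.lam| * ‖F.pair‖ * ‖F.charge v‖ ^ 2 := by rw [hB]; ring
  rw [action, h9]
  linarith

lemma bddBelow_action (hq : 2 < q) : BddBelow (range F.action) := by
  obtain ⟨M, hM⟩ := F.action_coercive hq
  refine ⟨-M, ?_⟩
  rintro _ ⟨v, rfl⟩
  have h := hM v
  have : 0 ≤ 1 / (2 * q) * ‖F.val v‖ ^ q := by positivity
  nlinarith [sq_nonneg ‖F.grad v‖]

/-- Elements of bounded action have bounded charge and are bounded in `L^q`. -/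
lemma exists_bound_of_action_le (hq : 2 < q) (s : ℝ) :
    ∃ R : ℝ, ∀ v, F.action v ≤ s → ‖F.charge v‖ ≤ R ∧ ‖F.val v‖ ≤ R := by
  obtain ⟨M, hM⟩ := F.action_coercive hq
  obtain ⟨C, hC, hc⟩ := F.charge_le 1 one_pos
  set A := √(4 * |s + M|)
  set B := (2 * q * |s + M|) ^ (1 / q)
  refine ⟨max (1 * A + C * B) B, fun v hv => ?_⟩
  have h := hM v
  have h0 : 0 ≤ 1 / (2 * q) * ‖F.val v‖ ^ q := by positivity
  have h1 : ‖F.grad v‖ ≤ A := by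
    refine Real.le_sqrt_of_sq_le ?_
    linarith [le_abs_self (s + M)]
  have h2 : ‖F.val v‖ ≤ B := by
    have h3 : ‖F.val v‖ ^ q ≤ 2 * q * |s + M| := by
      have : 1 / (2 * q) * ‖F.val v‖ ^ q ≤ |s + M| := by
        nlinarith [sq_nonneg ‖F.grad v‖, le_abs_self (s + M)]
      rwa [one_div, inv_mul_le_iff₀ (by positivity)] at this
    have h4 := Real.rpow_le_rpow (by positivity) h3 (by positivity : 0 ≤ 1 / q)
    rwa [← Real.rpow_mul (norm_nonneg _), mul_one_div_cancel (by linarith), Real.rpow_one] at h4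
  refine ⟨(hc v).trans (le_max_of_le_left ?_), h2.trans (le_max_right _ _)⟩
  gcongr

/-- A direction in which the quadratic part is negative makes the action negative near `0`, since
the `L^q` term is of higher order. -/
lemma exists_action_neg (hq : 2 < q) {v : X} (hv : F.quad v < 0) : ∃ w, F.action w < 0 := by
  have h1 : Tendsto (fun t : ℝ => 1 / q * (t ^ (q - 2) * ‖F.val v‖ ^ q)) (𝓝 0)
      (𝓝 (1 / q * ((0 : ℝ) ^ (q - 2) * ‖F.val v‖ ^ q))) :=
    (((Real.continuousAt_rpow_const 0 (q - 2) (Or.inr (by linarith))).tendsto).mul_const _).const_mul _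
  rw [Real.zero_rpow (by linarith), zero_mul, mul_zero] at h1
  have hneg : (0 : ℝ) < -(1 / 2 * F.quad v) := by linarith
  have h1' := h1.mono_left (nhdsWithin_le_nhds (s := Ioi 0))
  have h2 := h1'.eventually_lt_const hneg
  obtain ⟨t, ht, ht0⟩ := (h2.and self_mem_nhdsWithin).exists
  have ht0 : 0 < t := ht0
  refine ⟨(t : ℂ) • v, ?_⟩
  have e : t ^ q = t ^ 2 * t ^ (q - 2) := by
    rw [← Real.rpow_natCast t 2, ← Real.rpow_add ht0]
    congr 1
    push_cast
    ring
  rw [action, F.quad_smul, map_smul, norm_smul, Complex.norm_real, Real.norm_of_nonneg ht0.le,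
    Real.mul_rpow ht0.le (norm_nonneg _), e]
  have := mul_pos (pow_pos ht0 2) (by linarith :
    0 < -(1 / 2 * F.quad v) - 1 / q * (t ^ (q - 2) * ‖F.val v‖ ^ q))
  linarith

/-- The zero function has no charge: the singularity of the Green function cannot be cancelled by a
regular part. -/
lemma charge_eq_zero_of_val_eq_zero {v : X} (hv : F.val v = 0) : F.charge v = 0 := by
  rw [← norm_le_zero_iff]
  refine le_of_forall_pos_le_add fun δ hδ => ?_
  obtain ⟨C, -, hc⟩ := F.charge_le (δ / (‖F.grad v‖ + 1)) (by positivity)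
  have h := hc v
  rw [hv, norm_zero, mul_zero, add_zero] at h
  rw [zero_add]
  refine h.trans ?_
  rw [div_mul_eq_mul_div, div_le_iff₀ (by positivity)]
  nlinarith [norm_nonneg (F.grad v)]

lemma action_nonneg_of_val_eq_zero (hq : 2 < q) {v : X} (hv : F.val v = 0) : 0 ≤ F.action v := by
  have := F.ω_nonneg
  rw [action, quad, F.charge_eq_zero_of_val_eq_zero hv, hv]
  simp only [norm_zero, map_zero, Complex.zero_re, mul_zero, zero_pow two_ne_zero, add_zero,
    sub_zero]
  positivity

/-- The action has vanishing derivative at a minimizer, because its second differences are at most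
quadratic. -/
lemma isLittleO_action_of_isMin (hq : 2 < q) {φ : X} (hφ : ∀ v, F.action φ ≤ F.action v) :
    (fun v => F.action v - F.action φ) =o[𝓝 φ] fun v => v - φ := by
  obtain ⟨C₁, hC₁, h₁⟩ := F.quad_le
  obtain ⟨C₂, hC₂, h₂⟩ := Lp_second_difference (μ := μ) hq
  set M := C₁ + 1 / q * (C₂ * (‖F.val‖ ^ 2 * (‖F.val φ‖ ^ q + 1) + ‖F.val‖ ^ q)) with hM
  have hM0 : 0 ≤ M := by positivity
  have hO : (fun v => F.action v - F.action φ) =O[𝓝 φ] fun v => ‖v - φ‖ ^ 2 := by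
    refine Asymptotics.IsBigO.of_bound M ?_
    filter_upwards [Metric.ball_mem_nhds φ one_pos] with v hv
    set h := v - φ with hh
    have hv' : φ + h = v := by rw [hh]; abel
    have hn : ‖h‖ ≤ 1 := by
      rw [hh, ← dist_eq_norm]
      exact (Metric.mem_ball.1 hv).le
    -- minimality at `φ - h` bounds the increment at `φ + h` by the second difference
    have k1 := hφ (φ - h)
    have k2 := F.quad_add_add_quad_sub φ h
    have k3 := h₂ (F.val φ) (F.val h)
    rw [← map_add, ← map_sub] at k3
    have k4 := h₁ h
    have k5 : ‖F.val h‖ ^ 2 ≤ ‖F.val‖ ^ 2 * ‖h‖ ^ 2 := by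
      rw [← mul_pow]
      gcongr
      exact F.val.le_opNorm h
    have k6 : ‖F.val h‖ ^ q ≤ ‖F.val‖ ^ q * ‖h‖ ^ 2 := by
      calc ‖F.val h‖ ^ q ≤ (‖F.val‖ * ‖h‖) ^ q := by
            gcongr
            exact F.val.le_opNorm h
        _ = ‖F.val‖ ^ q * ‖h‖ ^ q := Real.mul_rpow (norm_nonneg _) (norm_nonneg _)
        _ ≤ _ := by
          gcongr
          rw [← Real.rpow_natCast]
          exact Real.rpow_le_rpow_of_exponent_ge' (norm_nonneg _) hn (by norm_num)
            (by push_cast; linarith)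
    have k7 : C₂ * (‖F.val h‖ ^ 2 * (‖F.val φ‖ ^ q + 1) + ‖F.val h‖ ^ q) ≤
        C₂ * ((‖F.val‖ ^ 2 * ‖h‖ ^ 2) * (‖F.val φ‖ ^ q + 1) + ‖F.val‖ ^ q * ‖h‖ ^ 2) := by
      gcongr
    have k8 := mul_le_mul_of_nonneg_left (k3.trans (add_le_add_right k7 _))
      (by positivity : 0 ≤ 1 / q)
    have k9 := hφ v
    rw [Real.norm_of_nonneg (by linarith), Real.norm_of_nonneg (by positivity), ← hv']
    rw [hM]
    simp only [action] at k1 ⊢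
    linarith
  have ho : (fun v => ‖v - φ‖ ^ 2) =o[𝓝 φ] fun v => v - φ := by
    rw [← Asymptotics.isLittleO_norm_right]
    have : Tendsto (fun v => ‖v - φ‖) (𝓝 φ) (𝓝 0) := by
      have : Continuous fun v => ‖v - φ‖ := by fun_prop
      simpa using this.tendsto φ
    exact (Asymptotics.isLittleO_pow_id one_lt_two).comp_tendsto this
  exact hO.trans_isLittleO ho

/-- Minimizing sequences are relatively compact. After passing to a subsequence the charges
converge; for convergent charges the midpoint inequality makes the sequence a Cauchy sequence. -/
lemma exists_tendsto_of_tendsto_iInf [CompleteSpace X] (hq : 2 < q) {v : ℕ → X}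
    (hv : Tendsto (fun n => F.action (v n)) atTop (𝓝 (⨅ w, F.action w))) :
    ∃ v₀, F.action v₀ = (⨅ w, F.action w) ∧ ∃ k : ℕ → ℕ, StrictMono k ∧
      Tendsto (fun n => v (k n)) atTop (𝓝 v₀) := by
  set d := ⨅ w, F.action w with hd
  have hmin : ∀ w, d ≤ F.action w := fun w => ciInf_le (F.bddBelow_action hq) w
  obtain ⟨s, hs⟩ := hv.bddAbove_range
  obtain ⟨R, hR⟩ := F.exists_bound_of_action_le hq s
  have hR' : ∀ n, ‖F.charge (v n)‖ ≤ R ∧ ‖F.val (v n)‖ ≤ R := fun n => hR _ (hs ⟨n, rfl⟩)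
  obtain ⟨c, -, k, hk, hc⟩ := tendsto_subseq_of_bounded (Metric.isBounded_closedBall (x := (0 : ℂ)) (r := R))
    (fun n => mem_closedBall_zero_iff.2 (hR' n).1)
  set u : ℕ → X := fun n => v (k n) with hu
  have hSu : Tendsto (fun n => F.action (u n)) atTop (𝓝 d) := hv.comp hk.tendsto_atTop
  set h : ℕ × ℕ → X := fun n => ((1 / 2 : ℝ) : ℂ) • (u n.1 - u n.2) with hh
  have hfst : Tendsto (Prod.fst : ℕ × ℕ → ℕ) atTop atTop := by
    rw [← prod_atTop_atTop_eq]; exact tendsto_fst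
  have hsnd : Tendsto (Prod.snd : ℕ × ℕ → ℕ) atTop atTop := by
    rw [← prod_atTop_atTop_eq]; exact tendsto_snd
  have hch : Tendsto (fun n => ‖F.charge (h n)‖) atTop (𝓝 0) := by
    have h1 := ((hc.comp hfst).sub (hc.comp hsnd)).const_smul ((1 / 2 : ℝ) : ℂ)
    rw [sub_self, smul_zero] at h1
    refine h1.norm.congr' (Eventually.of_forall fun n => ?_) |>.trans (by rw [norm_zero])
    simp only [hh, map_smul, map_sub, hu, Function.comp]
  have hvh : ∀ n, ‖F.val (h n)‖ ≤ R := by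
    intro n
    simp only [hh, map_smul, map_sub, norm_smul, Complex.norm_real]
    have h1 := norm_sub_le (F.val (u n.1)) (F.val (u n.2))
    have h2 := (hR' (k n.1)).2
    have h3 := (hR' (k n.2)).2
    rw [Real.norm_of_nonneg (by norm_num)]
    linarith
  set e : ℕ × ℕ → ℝ := fun n => (F.action (u n.1) + F.action (u n.2)) / 2 - d +
    (|F.a| / 2 * ‖F.charge (h n)‖ ^ 2 + |F.lam| * ‖F.pair‖ * R * ‖F.charge (h n)‖) with he
  have he0 : Tendsto e atTop (𝓝 0) := by
    have h1 := ((((hSu.comp hfst).add (hSu.comp hsnd)).div_const 2).sub_const d).add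
      (((hch.pow 2).const_mul (|F.a| / 2)).add (hch.const_mul (|F.lam| * ‖F.pair‖ * R)))
    have e1 : (d + d) / 2 - d + (|F.a| / 2 * 0 ^ 2 + |F.lam| * ‖F.pair‖ * R * 0) = 0 := by ring
    rw [e1] at h1
    exact h1
  have hkey : ∀ n, 1 / 2 * (‖F.grad (h n)‖ ^ 2 + F.ω * ‖F.mass (h n)‖ ^ 2) +
      1 / q * ‖F.val (h n)‖ ^ q ≤ e n := by
    intro n
    have h1 := F.action_midpoint_add_le hq (u n.1) (u n.2)
    have h2 := hmin (((1 / 2 : ℝ) : ℂ) • (u n.1 + u n.2))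
    have h3 := F.quad_ge (h n)
    have h4 : |F.lam| * (‖F.charge (h n)‖ * (‖F.pair‖ * ‖F.val (h n)‖)) ≤
        |F.lam| * (‖F.charge (h n)‖ * (‖F.pair‖ * R)) := by
      gcongr
      exact hvh n
    change _ + F.action (h n) ≤ _ at h1
    have h5 : F.action (h n) = 1 / 2 * F.quad (h n) + 1 / q * ‖F.val (h n)‖ ^ q := rfl
    rw [h5] at h1
    simp only [he]
    linarith
  have hω : ∀ n, 0 ≤ F.ω * ‖F.mass (h n)‖ ^ 2 := fun n => mul_nonneg F.ω_nonneg (sq_nonneg _)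
  have hqn : ∀ n, 0 ≤ 1 / q * ‖F.val (h n)‖ ^ q := fun n => by positivity
  have hD : Tendsto (fun n => ‖F.grad (h n)‖) atTop (𝓝 0) := by
    have h1 : Tendsto (fun n => √(2 * e n)) atTop (𝓝 0) := by
      have := (Real.continuous_sqrt.tendsto _).comp (he0.const_mul 2)
      rwa [mul_zero, Real.sqrt_zero] at this
    refine squeeze_zero (fun _ => norm_nonneg _) (fun n => Real.le_sqrt_of_sq_le ?_) h1
    linarith [hkey n, hω n, hqn n]
  have hK : Tendsto (fun n => F.ω * ‖F.mass (h n)‖) atTop (𝓝 0) := by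
    have h1 : Tendsto (fun n => √(2 * F.ω * e n)) atTop (𝓝 0) := by
      have := (Real.continuous_sqrt.tendsto _).comp (he0.const_mul (2 * F.ω))
      rwa [mul_zero, Real.sqrt_zero] at this
    refine squeeze_zero (fun _ => mul_nonneg F.ω_nonneg (norm_nonneg _))
      (fun n => Real.le_sqrt_of_sq_le ?_) h1
    have h2 : F.ω * ‖F.mass (h n)‖ ^ 2 ≤ 2 * e n := by
      nlinarith [hkey n, hqn n, sq_nonneg ‖F.grad (h n)‖]
    have h3 := mul_le_mul_of_nonneg_left h2 F.ω_nonneg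
    linarith
  have hU : Tendsto (fun n => ‖F.val (h n)‖) atTop (𝓝 0) := by
    have h1 : Tendsto (fun n => (q * e n) ^ (1 / q)) atTop (𝓝 0) := by
      have hq0 : 0 < 1 / q := by positivity
      have := ((Real.continuousAt_rpow_const 0 (1 / q) (Or.inr hq0.le)).tendsto).comp
        (by simpa using he0.const_mul q)
      rwa [Real.zero_rpow hq0.ne'] at this
    refine squeeze_zero (fun _ => norm_nonneg _) (fun n => ?_) h1
    have h2 : 1 / q * ‖F.val (h n)‖ ^ q ≤ e n := by
      nlinarith [hkey n, hω n, sq_nonneg ‖F.grad (h n)‖]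
    rw [one_div, inv_mul_le_iff₀ (by linarith)] at h2
    have h4 := Real.rpow_le_rpow (by positivity) h2 (by positivity : 0 ≤ 1 / q)
    rwa [← Real.rpow_mul (norm_nonneg _), mul_one_div_cancel (by linarith), Real.rpow_one] at h4
  have hcauchy : CauchySeq u := by
    obtain ⟨C, hC⟩ := F.norm_le
    rw [cauchySeq_iff_tendsto_dist_atTop_0]
    have h1 := (((hD.add hch).add hU).add hK).const_mul (2 * C)
    simp only [add_zero, mul_zero] at h1
    refine squeeze_zero (fun _ => dist_nonneg) (fun n => ?_) h1
    have h2 := hC (h n)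
    have h3 : ‖h n‖ = 1 / 2 * dist (u n.1) (u n.2) := by
      rw [hh, norm_smul, Complex.norm_real, Real.norm_of_nonneg (by norm_num), dist_eq_norm]
    rw [h3] at h2
    linarith
  obtain ⟨v₀, hv₀⟩ := cauchySeq_tendsto_of_complete hcauchy
  exact ⟨v₀, tendsto_nhds_unique (((F.continuous_action hq).tendsto v₀).comp hv₀) hSu, k, hk, hv₀⟩

lemma exists_isMin [CompleteSpace X] (hq : 2 < q) : ∃ φ, F.action φ = ⨅ w, F.action w := by
  obtain ⟨a, -, ha, hmem⟩ := exists_seq_tendsto_sInf (range_nonempty F.action)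
    (F.bddBelow_action hq)
  choose v hv using hmem
  have : Tendsto (fun n => F.action (v n)) atTop (𝓝 (⨅ w, F.action w)) :=
    ha.congr fun n => (hv n).symm
  obtain ⟨φ, h, -⟩ := F.exists_tendsto_of_tendsto_iInf hq this
  exact ⟨φ, h⟩

end FormData

end PointInteraction

/-! ### The action of the point interaction -/

namespace PointInteraction

instance fact_one_le_ofReal_add_one (p : ℝ) [hp : Fact (1 < p)] :
    Fact (1 ≤ ENNReal.ofReal (p + 1)) :=
  ⟨by rw [ENNReal.one_le_ofReal]; linarith [hp.out]⟩

/-- The functional `u ↦ ∫ u g` on `L^q`, for `g` in the dual space. -/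
noncomputable def integralPairing {Y : Type*} [MeasurableSpace Y] {μ : Measure Y} (q r : ℝ≥0∞)
    [Fact (1 ≤ q)] [Fact (1 ≤ r)] [q.HolderConjugate r] (g : Lp ℂ r μ) : Lp ℂ q μ →L[ℂ] ℂ :=
  LinearMap.mkContinuous
    { toFun := fun u => ∫ x, u x * g x ∂μ
      map_add' := fun u v => by
        have h1 : Integrable (fun x => u x * g x) μ := (Lp.memLp u).integrable_mul (Lp.memLp g)
        have h2 : Integrable (fun x => v x * g x) μ := (Lp.memLp v).integrable_mul (Lp.memLp g)
        rw [← integral_add h1 h2]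
        refine integral_congr_ae ?_
        filter_upwards [Lp.coeFn_add u v] with x hx
        rw [hx, Pi.add_apply, add_mul]
      map_smul' := fun c u => by
        rw [RingHom.id_apply, smul_eq_mul, ← integral_const_mul]
        refine integral_congr_ae ?_
        filter_upwards [Lp.coeFn_smul c u] with x hx
        rw [hx, Pi.smul_apply, smul_eq_mul, mul_assoc] }
    ‖g‖ fun u => (norm_integral_mul_le u g).trans_eq (mul_comm _ _)

/-- The regular part is controlled by the function and the charge. -/
lemma norm_regular_le {N : ℕ} {lam : ℝ} {q r : ℝ≥0∞} [Fact (1 ≤ q)] [Fact (1 ≤ r)] (hqr : q = r)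
    (hG : MemLp (fun x : Space N => (green N lam x : ℂ)) r) (g : regularSpace N q) (c : ℂ)
    (U : Lp ℂ r (volume : Measure (Space N)))
    (hU : U =ᵐ[volume] fun x => g.1.1 x + c * (green N lam x : ℂ)) :
    ‖g.1.1‖ ≤ ‖U‖ + ‖hG.toLp _‖ * ‖c‖ := by
  subst hqr
  have e : g.1.1 = U - c • hG.toLp _ := by
    refine Lp.ext ?_
    filter_upwards [hU, Lp.coeFn_sub U (c • hG.toLp _), Lp.coeFn_smul c (hG.toLp _),
      hG.coeFn_toLp] with x h1 h2 h3 h4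
    rw [h2, Pi.sub_apply, h3, Pi.smul_apply, h4, h1, smul_eq_mul]
    ring
  rw [e]
  refine (norm_sub_le _ _).trans_eq ?_
  rw [norm_smul, mul_comm]

/-- The exponent `p + 1` is subcritical for the singularity of the Green function. -/
lemma exponent_subcritical {N : ℕ} (hN : N = 2 ∨ N = 3) {p : ℝ} (h1 : 1 < p)
    (hp : N = 3 → p < 2) : (N : ℝ) / 2 * (1 - 2 / (p + 1)) < 2 - (N : ℝ) / 2 := by
  have h0 : 0 < 2 / (p + 1) := by positivity
  rcases hN with rfl | rfl
  · push_cast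
    linarith
  · have h2 : 2 / 3 < 2 / (p + 1) := by
      have := hp rfl
      gcongr
      linarith
    push_cast
    linarith

section

variable {N : ℕ} {p ω lam : ℝ} [hp1 : Fact (1 < p)]

lemma regExponent_zero (p : ℝ) : regExponent p 0 = ENNReal.ofReal (p + 1) := if_pos rfl

lemma regExponent_of_ne_zero (p : ℝ) (hω : ω ≠ 0) : regExponent p ω = 2 := if_neg hω

lemma memLp_green_add_one (hN : N = 2 ∨ N = 3) (hp : N = 3 → p < 2) (hlam : 0 < lam) :
    MemLp (fun x : Space N => (green N lam x : ℂ)) (ENNReal.ofReal (p + 1)) :=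
  memLp_green_of_two_le (by omega) hlam (by linarith [hp1.out])
    (exponent_subcritical hN hp1.out hp)

lemma memLp_green_regExponent (hN : N = 2 ∨ N = 3) (hp : N = 3 → p < 2) (hlam : 0 < lam) (ω : ℝ) :
    MemLp (fun x : Space N => (green N lam x : ℂ)) (regExponent p ω) := by
  unfold regExponent
  split_ifs
  · exact memLp_green_add_one hN hp hlam
  · exact memLp_two_green (by omega) hlam

lemma memLp_green_conjExponent (hN : N = 2 ∨ N = 3) (hlam : 0 < lam) :
    MemLp (fun x : Space N => (green N lam x : ℂ)) (ENNReal.ofReal (p + 1).conjExponent) := by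
  have h := hp1.out
  have e : (p + 1).conjExponent = (p + 1) / p := by
    rw [Real.conjExponent]
    congr 1
    ring
  refine memLp_green_of_le_two (by omega) hlam ?_ ?_
  · rw [e, one_le_div (by linarith)]
    linarith
  · rw [e, div_le_iff₀ (by linarith)]
    linarith

/-- Regular parts are in `L^{p+1}`. -/
lemma memLp_regular (hN : N = 2 ∨ N = 3) (hp : N = 3 → p < 2) {r : ℝ≥0∞} [Fact (1 ≤ r)]
    (hr : r = ENNReal.ofReal (p + 1) ∨ r = 2) (g : regularSpace N r) :
    MemLp g.1.1 (ENNReal.ofReal (p + 1)) := by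
  rcases hr with rfl | rfl
  · exact Lp.memLp _
  · refine memLp_of_regularSpace_two (by linarith [hp1.out])
      ((exponent_subcritical hN hp1.out hp).trans_le ?_) g
    rcases hN with rfl | rfl <;> norm_num

lemma regExponent_eq_or (p ω : ℝ) :
    regExponent p ω = ENNReal.ofReal (p + 1) ∨ regExponent p ω = 2 := by
  unfold regExponent
  split_ifs <;> simp

lemma memLp_two_regular {r : ℝ≥0∞} [Fact (1 ≤ r)] (hr : r = 2) (g : regularSpace N r) :
    MemLp g.1.1 2 := hr ▸ Lp.memLp g.1.1

/-- The map `v = (f, c) ↦ f + c G` into `L^r`, provided that regular parts and `G` are in `L^r`. -/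
noncomputable def functionMap {r : ℝ≥0∞} [Fact (1 ≤ r)]
    (h : ∀ g : regularSpace N (regExponent p ω), MemLp g.1.1 r)
    (hG : MemLp (fun x : Space N => (green N lam x : ℂ)) r) :
    EnergySpace N p ω →L[ℂ] Lp ℂ r (volume : Measure (Space N)) :=
  (regularInclusion h).comp (ContinuousLinearMap.fst ℂ _ ℂ) +
    (ContinuousLinearMap.snd ℂ (regularSpace N (regExponent p ω)) ℂ).smulRight (hG.toLp _)

lemma coeFn_functionMap {r : ℝ≥0∞} [Fact (1 ≤ r)]
    (h : ∀ g : regularSpace N (regExponent p ω), MemLp g.1.1 r)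
    (hG : MemLp (fun x : Space N => (green N lam x : ℂ)) r) (v : EnergySpace N p ω) :
    functionMap h hG v =ᵐ[volume] toFunction lam v := by
  have e : functionMap h hG v = regularInclusion h v.1 + v.2 • hG.toLp _ := rfl
  rw [e]
  filter_upwards [Lp.coeFn_add (regularInclusion h v.1) (v.2 • hG.toLp _),
    coeFn_regularInclusion h v.1, Lp.coeFn_smul v.2 (hG.toLp _), hG.coeFn_toLp] with x h1 h2 h3 h4
  rw [h1, Pi.add_apply, h2, h3, Pi.smul_apply, h4, smul_eq_mul]
  rfl

/-- The gradient of the regular part, as a continuous linear map. -/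
noncomputable def gradMap (N : ℕ) (p ω : ℝ) [Fact (1 < p)] :
    EnergySpace N p ω →L[ℂ] PiLp 2 (fun _ : Fin N => Lp ℂ 2 (volume : Measure (Space N))) :=
  (ContinuousLinearMap.snd ℂ (Lp ℂ (regExponent p ω) (volume : Measure (Space N))) _).comp
    ((regularSpace N (regExponent p ω)).subtypeL.comp (ContinuousLinearMap.fst ℂ _ ℂ))

/-- The function `f + c G` in `L²`; by convention `0` for `ω = 0`, when it need not be in `L²`
and the action has no mass term. -/
noncomputable def massMap (p ω : ℝ) [Fact (1 < p)] (hN : N < 4) (hlam : 0 < lam) :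
    EnergySpace N p ω →L[ℂ] Lp ℂ 2 (volume : Measure (Space N)) :=
  open Classical in
  if h : ω = 0 then 0 else functionMap (memLp_two_regular (regExponent_of_ne_zero p h))
    (memLp_two_green hN hlam)

lemma coeFn_massMap (hω : ω ≠ 0) (hN : N < 4) (hlam : 0 < lam) (v : EnergySpace N p ω) :
    massMap p ω hN hlam v =ᵐ[volume] toFunction lam v := by
  rw [massMap, dif_neg hω]
  exact coeFn_functionMap _ _ v

lemma exists_norm_regPart_le (hN : N = 2 ∨ N = 3) (hp : N = 3 → p < 2) (hω : 0 ≤ ω)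
    (hlam : 0 < lam) : ∃ C : ℝ, 1 ≤ C ∧ ∀ v : EnergySpace N p ω, ‖v.1.1.1‖ ≤ C * (‖v.2‖ +
      ‖functionMap (memLp_regular hN hp (regExponent_eq_or p ω))
        (memLp_green_add_one hN hp hlam) v‖ + ω * ‖massMap p ω (by omega) hlam v‖) := by
  rcases hω.eq_or_lt with h | h
  · obtain ⟨A, hA, h1⟩ : ∃ A : ℝ, 0 ≤ A ∧ ∀ v : EnergySpace N p ω, ‖v.1.1.1‖ ≤
        ‖functionMap (memLp_regular hN hp (regExponent_eq_or p ω))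
          (memLp_green_add_one hN hp hlam) v‖ + A * ‖v.2‖ :=
      ⟨_, norm_nonneg _, fun v => norm_regular_le (by rw [← h]; exact regExponent_zero p)
        (memLp_green_add_one hN hp hlam) v.1 v.2 _
        (coeFn_functionMap (memLp_regular hN hp (regExponent_eq_or p ω))
          (memLp_green_add_one hN hp hlam) v)⟩
    refine ⟨1 + A, le_add_of_nonneg_right hA, fun v => (h1 v).trans ?_⟩
    have h2 : 0 ≤ ω * ‖massMap p ω (by omega : N < 4) hlam v‖ := mul_nonneg hω (norm_nonneg _)
    generalize ω * ‖massMap p ω (by omega : N < 4) hlam v‖ = M at h2 ⊢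
    have h3 := norm_nonneg (functionMap (memLp_regular hN hp (regExponent_eq_or p ω))
      (memLp_green_add_one hN hp hlam) v)
    generalize ‖functionMap (memLp_regular hN hp (regExponent_eq_or p ω))
      (memLp_green_add_one hN hp hlam) v‖ = B at h3 ⊢
    linarith [norm_nonneg v.2, mul_nonneg hA h3, mul_nonneg hA h2]
  · obtain ⟨A, hA, h1⟩ : ∃ A : ℝ, 0 ≤ A ∧ ∀ v : EnergySpace N p ω, ‖v.1.1.1‖ ≤
        ‖massMap p ω (by omega : N < 4) hlam v‖ + A * ‖v.2‖ :=
      ⟨_, norm_nonneg _, fun v => norm_regular_le (regExponent_of_ne_zero p h.ne')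
        (memLp_two_green (by omega) hlam) v.1 v.2 _ (coeFn_massMap h.ne' (by omega) hlam v)⟩
    have hi : 0 < ω⁻¹ := inv_pos.2 h
    refine ⟨1 + A + ω⁻¹, by linarith, fun v => (h1 v).trans ?_⟩
    have h2 := norm_nonneg (massMap p ω (by omega : N < 4) hlam v)
    generalize ‖massMap p ω (by omega : N < 4) hlam v‖ = M at h2 ⊢
    have h3 := norm_nonneg (functionMap (memLp_regular hN hp (regExponent_eq_or p ω))
      (memLp_green_add_one hN hp hlam) v)
    generalize ‖functionMap (memLp_regular hN hp (regExponent_eq_or p ω))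
      (memLp_green_add_one hN hp hlam) v‖ = B at h3 ⊢
    have e : ω⁻¹ * (ω * M) = M := by field_simp
    have h4 := mul_nonneg (by linarith : 0 ≤ 1 + A) (mul_nonneg hω h2)
    have h5 := mul_nonneg (by linarith : 0 ≤ 1 + A + ω⁻¹) h3
    have h6 := mul_nonneg (by linarith : 0 ≤ 1 + ω⁻¹) (norm_nonneg v.2)
    linarith

lemma norm_energySpace_le (hN : N = 2 ∨ N = 3) (hp : N = 3 → p < 2) (hω : 0 ≤ ω) (hlam : 0 < lam) :
    ∃ C : ℝ, ∀ v : EnergySpace N p ω, ‖v‖ ≤ C * (‖gradMap N p ω v‖ + ‖v.2‖ +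
      ‖functionMap (memLp_regular hN hp (regExponent_eq_or p ω))
        (memLp_green_add_one hN hp hlam) v‖ + ω * ‖massMap p ω (by omega) hlam v‖) := by
  obtain ⟨C, hC, h⟩ := exists_norm_regPart_le (p := p) (ω := ω) hN hp hω hlam
  refine ⟨C, fun v => ?_⟩
  have h1 := h v
  have e : ‖v‖ = max (max ‖v.1.1.1‖ ‖gradMap N p ω v‖) ‖v.2‖ := rfl
  rw [e]
  have h2 : 0 ≤ ω * ‖massMap p ω (by omega : N < 4) hlam v‖ := mul_nonneg hω (norm_nonneg _)
  generalize ω * ‖massMap p ω (by omega : N < 4) hlam v‖ = M at h1 h2 ⊢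
  have h3 := norm_nonneg (functionMap (memLp_regular hN hp (regExponent_eq_or p ω))
    (memLp_green_add_one hN hp hlam) v)
  generalize ‖functionMap (memLp_regular hN hp (regExponent_eq_or p ω))
    (memLp_green_add_one hN hp hlam) v‖ = B at h1 h3 ⊢
  have h4 := norm_nonneg (gradMap N p ω v)
  generalize ‖gradMap N p ω v‖ = D at h4 ⊢
  have h5 := norm_nonneg v.2
  generalize ‖v.2‖ = c at h1 h5 ⊢
  have h6 := mul_nonneg (sub_nonneg.2 hC) h4
  have h7 := mul_nonneg (sub_nonneg.2 hC) h5
  have h8 := mul_nonneg (zero_le_one.trans hC) h2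
  have h9 := mul_nonneg (zero_le_one.trans hC) h3
  refine max_le (max_le ?_ ?_) ?_ <;> linarith

/-- The action as an instance of the abstract one. -/
noncomputable def formData (N : ℕ) (α p ω lam : ℝ) [hp1 : Fact (1 < p)] (hN : N = 2 ∨ N = 3)
    (hp : N = 3 → p < 2) (hω : 0 ≤ ω) (hlam : 0 < lam) :
    FormData (EnergySpace N p ω) (PiLp 2 (fun _ : Fin N => Lp ℂ 2 (volume : Measure (Space N))))
      (Lp ℂ 2 (volume : Measure (Space N))) (volume : Measure (Space N)) (p + 1) :=
  have hconj : (p + 1).HolderConjugate (p + 1).conjExponent :=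
    .conjExponent (by linarith [hp1.out])
  have hc1 : Fact (1 ≤ ENNReal.ofReal (p + 1).conjExponent) :=
    ⟨by rw [ENNReal.one_le_ofReal]; exact hconj.symm.lt.le⟩
  have hh1 : (ENNReal.ofReal (p + 1)).HolderConjugate (ENNReal.ofReal (p + 1).conjExponent) :=
    hconj.ennrealOfReal
  have hh2 : (ENNReal.ofReal (p + 1).conjExponent).HolderConjugate (ENNReal.ofReal (p + 1)) :=
    hconj.symm.ennrealOfReal
  { grad := gradMap N p ω
    charge := ContinuousLinearMap.snd ℂ _ ℂ
    val := functionMap (memLp_regular hN hp (regExponent_eq_or p ω)) (memLp_green_add_one hN hp hlam)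
    mass := massMap p ω (by omega) hlam
    pair := integralPairing _ (ENNReal.ofReal (p + 1).conjExponent)
      ((memLp_green_conjExponent hN hlam).toLp _)
    a := α + beta N lam + lam * ∫ x : Space N, green N lam x ^ 2
    lam := lam
    ω := ω
    ω_nonneg := hω
    charge_le := fun ε hε => by
      obtain ⟨C, hC, h⟩ := charge_estimate (N := N) (by omega) (by omega) hlam hε
        (q := regExponent p ω) (r := ENNReal.ofReal (p + 1))
        (r' := ENNReal.ofReal (p + 1).conjExponent)
      exact ⟨C, hC, fun v => h v.1 v.2 _ (coeFn_functionMap _ _ v)⟩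
    norm_le := norm_energySpace_le hN hp hω hlam }

variable {α : ℝ} (hN : N = 2 ∨ N = 3) (hp : N = 3 → p < 2) (hω : 0 ≤ ω) (hlam : 0 < lam)

lemma coeFn_formData_val (v : EnergySpace N p ω) :
    (formData N α p ω lam hN hp hω hlam).val v =ᵐ[volume] toFunction lam v :=
  coeFn_functionMap _ _ v

lemma formData_pair_val (v : EnergySpace N p ω) :
    (formData N α p ω lam hN hp hω hlam).pair ((formData N α p ω lam hN hp hω hlam).val v) =
      ∫ x, toFunction lam v x * (green N lam x : ℂ) := by
  refine integral_congr_ae ?_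
  filter_upwards [coeFn_formData_val (α := α) hN hp hω hlam v,
    (memLp_green_conjExponent (p := p) hN hlam).coeFn_toLp] with x h1 h2
  rw [h1, h2]

lemma formData_mass (v : EnergySpace N p ω) :
    ω * ‖(formData N α p ω lam hN hp hω hlam).mass v‖ ^ 2 = ω * ∫ x, ‖toFunction lam v x‖ ^ 2 := by
  rcases eq_or_ne ω 0 with rfl | h
  · rw [zero_mul, zero_mul]
  · rw [Lp_two_norm_sq_eq]
    congr 1
    refine integral_congr_ae ?_
    filter_upwards [coeFn_massMap h (by omega) hlam v] with x hx
    rw [← hx]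
    rfl

lemma formData_quad (v : EnergySpace N p ω) :
    (formData N α p ω lam hN hp hω hlam).quad v =
      quadForm α lam v + ω * ∫ x, ‖toFunction lam v x‖ ^ 2 := by
  rw [FormData.quad, formData_pair_val]
  exact congrArg _ (formData_mass hN hp hω hlam v)

lemma formData_action (v : EnergySpace N p ω) :
    (formData N α p ω lam hN hp hω hlam).action v = action α lam v := by
  have h1 : ‖(formData N α p ω lam hN hp hω hlam).val v‖ ^ (p + 1) =
      ∫ x, ‖toFunction lam v x‖ ^ (p + 1) := by
    rw [Lp_norm_rpow_eq (by linarith [hp1.out])]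
    refine integral_congr_ae ?_
    filter_upwards [coeFn_formData_val (α := α) hN hp hω hlam v] with x hx
    rw [hx]
  rw [FormData.action, formData_quad, h1, action]
  ring

/-- The quadratic part of the action is negative at the eigenfunction `G_{ω_α}`. -/
lemma exists_quad_neg (hα : N = 3 → α < 0) (hω' : ω < omegaMax N α) :
    ∃ v, (formData N α p ω lam hN hp hω hlam).quad v < 0 := by
  have hN4 : N < 4 := by omega
  have hm := omegaMax_pos hN hα
  set m := omegaMax N α with hmdef
  obtain ⟨g, hg, hg2⟩ := exists_regular_green_sub hN4 hm hlam
    (memLp_green_regExponent (p := p) hN hp hm ω) (memLp_green_regExponent (p := p) hN hp hlam ω)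
  refine ⟨(g, 1), ?_⟩
  have hfun : toFunction (p := p) (ω := ω) lam (g, 1) =ᵐ[volume]
      fun x => (green N m x : ℂ) := by
    filter_upwards [hg] with x hx
    change g.1.1 x + 1 * (green N lam x : ℂ) = _
    rw [hx]
    ring
  have e1 : ∫ x, toFunction (p := p) (ω := ω) lam (g, 1) x * (green N lam x : ℂ) =
      ((∫ ξ : Space N, symbol N lam ξ * symbol N m ξ : ℝ) : ℂ) := by
    rw [← integral_green_mul_green hN4 hlam hm, ← integral_complex_ofReal]
    refine integral_congr_ae ?_
    filter_upwards [hfun] with x hx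
    rw [hx]
    push_cast
    ring
  have e2 : ∫ x, ‖toFunction (p := p) (ω := ω) lam (g, 1) x‖ ^ 2 =
      ∫ ξ : Space N, symbol N m ξ * symbol N m ξ := by
    rw [← integral_green_mul_green hN4 hm hm]
    refine integral_congr_ae ?_
    filter_upwards [hfun] with x hx
    rw [hx, Complex.norm_real, Real.norm_eq_abs, sq_abs, sq]
  have e3 : ∫ x : Space N, green N lam x ^ 2 = ∫ ξ : Space N, symbol N lam ξ * symbol N lam ξ := by
    rw [← integral_green_mul_green hN4 hlam hlam]
    simp only [sq]
  have h1 := mul_integral_symbols hN hlam hm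
  have h2 := alpha_add_beta_omegaMax hN hα
  rw [← hmdef] at h2
  have h3 := mul_pos (sub_pos.2 hω') (integral_symbol_sq_pos hN4 hm)
  rw [formData_quad, quadForm, e1, e2, e3]
  have e4 : gradPart (p := p) (ω := ω) (g, 1) = g.1.2 := rfl
  rw [e4, hg2]
  simp only [map_one, one_mul, norm_one, Complex.ofReal_re]
  linarith

end

end PointInteraction

theorem theorem1 (N : ℕ) (hN : N = 2 ∨ N = 3) (α p ω lam : ℝ) [Fact (1 < p)]
    (hp : N = 3 → p < 2) (hα : N = 3 → α < 0)
    (hω : 0 ≤ ω) (hω' : ω < PointInteraction.omegaMax N α) (hlam : 0 < lam) :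
    (PointInteraction.solutions N α p ω lam).Nonempty ∧
    BddBelow (Set.range fun v : PointInteraction.EnergySpace N p ω =>
      PointInteraction.action α lam v) ∧
    PointInteraction.leastAction N α p ω lam < 0 ∧
    (PointInteraction.minimizers N α p ω lam).Nonempty ∧
    PointInteraction.minimizers N α p ω lam ⊆ PointInteraction.solutions N α p ω lam ∧
    (∀ v : ℕ → PointInteraction.EnergySpace N p ω,
      Tendsto (fun n => PointInteraction.action α lam (v n)) atTop
        (𝓝 (PointInteraction.leastAction N α p ω lam)) →
      ∃ v₀ ∈ PointInteraction.minimizers N α p ω lam, ∃ k : ℕ → ℕ,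
        StrictMono k ∧ Tendsto (fun n => v (k n)) atTop (𝓝 v₀)) := by
  have hq : 2 < p + 1 := by linarith [Fact.out (p := 1 < p)]
  set F := PointInteraction.formData N α p ω lam hN hp hω hlam with hF
  have hact : F.action = fun v => PointInteraction.action α lam v :=
    funext fun v => PointInteraction.formData_action hN hp hω hlam v
  have hd : PointInteraction.leastAction N α p ω lam = ⨅ v, F.action v := by
    rw [hact]
    rfl
  have hbdd := F.bddBelow_action hq
  have hneg : PointInteraction.leastAction N α p ω lam < 0 := by
    obtain ⟨v, hv⟩ := PointInteraction.exists_quad_neg (p := p) hN hp hω hlam hα hω'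
    obtain ⟨w, hw⟩ := F.exists_action_neg hq hv
    rw [hd]
    exact (ciInf_le hbdd w).trans_lt hw
  have hmin : (PointInteraction.minimizers N α p ω lam).Nonempty := by
    obtain ⟨φ, hφ⟩ := F.exists_isMin hq
    refine ⟨φ, ?_⟩
    rw [← hd, hact] at hφ
    exact hφ
  have hsub : PointInteraction.minimizers N α p ω lam ⊆
      PointInteraction.solutions N α p ω lam := by
    intro φ hφ
    have hφ' : F.action φ = ⨅ v, F.action v := by
      rw [← hd, hact]
      exact hφ
    refine ⟨fun h0 => ?_, ?_⟩
    · have hval : F.val φ = 0 := by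
        refine Lp.ext ?_
        filter_upwards [PointInteraction.coeFn_formData_val (α := α) hN hp hω hlam φ, h0,
          Lp.coeFn_zero ℂ (ENNReal.ofReal (p + 1)) volume] with x h1 h2 h3
        rw [h1, h2, h3]
      have := F.action_nonneg_of_val_eq_zero hq hval
      rw [hφ', ← hd] at this
      exact absurd this hneg.not_ge
    · have h := F.isLittleO_action_of_isMin hq fun v => hφ'.trans_le (ciInf_le hbdd v)
      rw [hact] at h
      refine HasFDerivAt.of_isLittleO ?_
      simpa using h
  refine ⟨hmin.mono hsub, ?_, hneg, hmin, hsub, fun v hv => ?_⟩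
  · rw [hact] at hbdd
    exact hbdd
  · rw [hd] at hv
    obtain ⟨v₀, h0, k, hk, hlim⟩ := F.exists_tendsto_of_tendsto_iInf hq (v := v) (by
      rw [hact]
      rw [hact] at hv
      exact hv)
    refine ⟨v₀, ?_, k, hk, hlim⟩
    rw [← hd, hact] at h0
    exact h0
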